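/- Let $m\ge 0$, let $\theta=(\theta_{ij})$ be a real skew-symmetric $m\times m$ matrix, and let $\rho_{ij}=\exp(2\pi i\,\theta_{ij})$. Let $A_\theta=C(T^m_\theta)$ (the noncommutative torus) be the universal unital C*-algebra generated by unitaries $U_1,\dots,U_m$ subject to $U_iU_j=\rho_{ji}U_jU_i$, and let $C(S^{2m}_\theta)$ (the $\theta$-deformed even sphere) be the universal unital C*-algebra generated by normal elements $z_1,\dots,z_m$ and a self-adjoint element $x$ subject to $$z_1z_1^*+\dots+z_mz_m^*+x^2=1,\qquad z_iz_j=\rho_{ji}z_jz_i,\qquad xz_i=z_ix .$$ Let $S^m_{+,m+1}=\{(t_1,\dots,t_{m+1})\in\mathbb{R}^{m+1}: t_1^2+\dots+t_{m+1}^2=1,\ t_k\ge 0\text{ for all }k\le m\}$. For $i\le m$ let $S(i)=\{t\in S^m_{+,m+1}: t_i=0\}$, and let $A_\theta(i)$ be the unital C*-subalgebra of $A_\theta$ generated by the $U_j$ with $j\ne i$. Let $\mathfrak{A}$ be the C*-subalgebra of $C(S^m_{+,m+1},A_\theta)$ consisting of the continuous functions $f$ with $f(S(i))\subseteq A_\theta(i)$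 for all $i\le m$. Then $C(S^{2m}_\theta)\cong\mathfrak{A}$ as C*-algebras: there is a $*$-isomorphism $C(S^{2m}_\theta)\to\mathfrak{A}$ that sends each $z_i$ to the function $t\mapsto t_iU_i$ and $x$ to the function $t\mapsto t_{m+1}\cdot 1$. In this sense the even $\theta$-sphere is a continuous field of noncommutative tori. -/

import Mathlib

noncomputable section

/-! ### The free unital complex `*`-algebra -/

/-- The free unital complex `*`-algebra on `ι`: noncommutative polynomials in letters `g i` (the
left summand) and their formal adjoints (the right summand). -/
def FreeStarAlgebra (ι : Type) : Type := FreeAlgebra ℂ (ι ⊕ ι)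

namespace FreeStarAlgebra

variable {ι : Type}

instance : Ring (FreeStarAlgebra ι) := inferInstanceAs (Ring (FreeAlgebra ℂ (ι ⊕ ι)))

instance : Algebra ℂ (FreeStarAlgebra ι) :=
  inferInstanceAs (Algebra ℂ (FreeAlgebra ℂ (ι ⊕ ι)))

/-- The generator with index `i`. -/
def gen (i : ι) : FreeStarAlgebra ι := FreeAlgebra.ι ℂ (Sum.inl i)

/-- The conjugate-linear, product-reversing ring homomorphism that exchanges each generator with
its formal adjoint. -/
def starHom (ι : Type) : FreeAlgebra ℂ (ι ⊕ ι) →+* (FreeAlgebra ℂ (ι ⊕ ι))ᵐᵒᵖ :=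
  letI : Algebra ℂ (FreeAlgebra ℂ (ι ⊕ ι))ᵐᵒᵖ :=
    Algebra.compHom (FreeAlgebra ℂ (ι ⊕ ι))ᵐᵒᵖ (starRingEnd ℂ)
  (FreeAlgebra.lift ℂ
    (fun x : ι ⊕ ι => MulOpposite.op (FreeAlgebra.ι ℂ x.swap))).toRingHom

theorem starHom_ι (x : ι ⊕ ι) :
    starHom ι (FreeAlgebra.ι ℂ x) = MulOpposite.op (FreeAlgebra.ι ℂ x.swap) := by
  let inst : Algebra ℂ (FreeAlgebra ℂ (ι ⊕ ι))ᵐᵒᵖ :=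
    Algebra.compHom (FreeAlgebra ℂ (ι ⊕ ι))ᵐᵒᵖ (starRingEnd ℂ)
  exact FreeAlgebra.lift_ι_apply (R := ℂ) _ x

theorem starHom_algebraMap (c : ℂ) :
    starHom ι (algebraMap ℂ _ c) = MulOpposite.op (algebraMap ℂ _ (starRingEnd ℂ c)) := by
  let inst : Algebra ℂ (FreeAlgebra ℂ (ι ⊕ ι))ᵐᵒᵖ :=
    Algebra.compHom (FreeAlgebra ℂ (ι ⊕ ι))ᵐᵒᵖ (starRingEnd ℂ)
  exact (FreeAlgebra.lift ℂ
    (fun x : ι ⊕ ι => MulOpposite.op (FreeAlgebra.ι ℂ x.swap))).commutes c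

theorem starHom_starHom (a : FreeAlgebra ℂ (ι ⊕ ι)) :
    (starHom ι (starHom ι a).unop).unop = a := by
  induction a using FreeAlgebra.induction with
  | grade0 r => simp [starHom_algebraMap]
  | grade1 x => simp [starHom_ι]
  | mul a b ha hb => simp [ha, hb]
  | add a b ha hb => simp [ha, hb]

instance : StarRing (FreeStarAlgebra ι) where
  star a := (starHom ι a).unop
  star_involutive a := starHom_starHom a
  star_mul a b := congrArg MulOpposite.unop (map_mul (starHom ι) a b)
  star_add a b := congrArg MulOpposite.unop (map_add (starHom ι) a b)

theorem star_def (a : FreeStarAlgebra ι) : star a = (starHom ι a).unop := rfl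

theorem star_gen (i : ι) : star (gen i) = FreeAlgebra.ι ℂ (Sum.inr i) :=
  congrArg MulOpposite.unop (starHom_ι (Sum.inl i))

instance : StarModule ℂ (FreeStarAlgebra ι) where
  star_smul c a := by
    rw [Algebra.smul_def, star_mul, Algebra.smul_def, Algebra.commutes]
    congr 1
    exact congrArg MulOpposite.unop (starHom_algebraMap c)

theorem induction {motive : FreeStarAlgebra ι → Prop}
    (algebraMap : ∀ c : ℂ, motive (algebraMap ℂ _ c)) (gen : ∀ i, motive (gen i))
    (star_gen : ∀ i, motive (star (FreeStarAlgebra.gen i)))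
    (mul : ∀ a b, motive a → motive b → motive (a * b))
    (add : ∀ a b, motive a → motive b → motive (a + b)) (a : FreeStarAlgebra ι) : motive a := by
  refine FreeAlgebra.induction (R := ℂ) (X := ι ⊕ ι) (motive := motive) algebraMap ?_ mul add a
  rintro (i | i)
  · exact gen i
  · exact FreeStarAlgebra.star_gen i ▸ star_gen i

end FreeStarAlgebra

/-! ### C*-seminorms and their completions -/

/-- A C*-seminorm on a complex `*`-algebra. -/
structure CStarSeminorm (P : Type) [Ring P] [StarRing P] [Algebra ℂ P] extends
    Seminorm ℂ P where
  mul_le' : ∀ a b : P, toFun (a * b) ≤ toFun a * toFun b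
  star_mul_self' : ∀ a : P, toFun (star a * a) = toFun a * toFun a

namespace CStarSeminorm

variable {P : Type} [Ring P] [StarRing P] [Algebra ℂ P]

instance : CoeFun (CStarSeminorm P) (fun _ => P → ℝ) := ⟨fun p => p.toSeminorm⟩

theorem mul_le (p : CStarSeminorm P) (a b : P) : p (a * b) ≤ p a * p b := p.mul_le' a b

theorem star_mul_self (p : CStarSeminorm P) (a : P) : p (star a * a) = p a * p a :=
  p.star_mul_self' a

theorem nonneg (p : CStarSeminorm P) (a : P) : 0 ≤ p a := apply_nonneg p.toSeminorm a

theorem le_star (p : CStarSeminorm P) (a : P) : p a ≤ p (star a) := by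
  by_contra! h
  have h1 := p.star_mul_self a
  have h2 := p.mul_le (star a) a
  have h3 := p.nonneg (star a)
  nlinarith

theorem star_eq (p : CStarSeminorm P) (a : P) : p (star a) = p a :=
  le_antisymm (by simpa using p.le_star (star a)) (p.le_star a)

theorem one_le_one (p : CStarSeminorm P) : p 1 ≤ 1 := by
  have h := p.star_mul_self 1
  simp only [star_one, mul_one] at h
  have := p.nonneg 1
  nlinarith

/-- The algebra `P`, equipped with the seminorm `p`. -/
def Carrier (_p : CStarSeminorm P) : Type := P

variable (p : CStarSeminorm P)

instance : Ring p.Carrier := inferInstanceAs (Ring P)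
instance : StarRing p.Carrier := inferInstanceAs (StarRing P)
instance : Algebra ℂ p.Carrier := inferInstanceAs (Algebra ℂ P)
instance [StarModule ℂ P] : StarModule ℂ p.Carrier := inferInstanceAs (StarModule ℂ P)

instance : SeminormedRing p.Carrier where
  __ : Ring p.Carrier := inferInstance
  __ : SeminormedAddCommGroup p.Carrier := p.toSeminorm.toSeminormedAddCommGroup
  norm_mul_le a b := p.mul_le a b

theorem norm_def (a : p.Carrier) : ‖a‖ = p (show P from a) := rfl

instance : NormedAlgebra ℂ p.Carrier where
  norm_smul_le c a := (map_smul_eq_mul p.toSeminorm c a).le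

instance : NormedStarGroup p.Carrier where
  norm_star_le a := (p.star_eq a).le

/-- The Hausdorff completion of `P` with respect to the C*-seminorm `p`. -/
def Completion (p : CStarSeminorm P) : Type := UniformSpace.Completion p.Carrier

instance : NormedRing p.Completion := inferInstanceAs (NormedRing (UniformSpace.Completion p.Carrier))

instance : CompleteSpace p.Completion :=
  inferInstanceAs (CompleteSpace (UniformSpace.Completion p.Carrier))

instance : NormedAlgebra ℂ p.Completion where
  __ : Algebra ℂ p.Completion := inferInstanceAs (Algebra ℂ (UniformSpace.Completion p.Carrier))
  norm_smul_le c a := by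
    have h : ∀ a : UniformSpace.Completion p.Carrier, ‖c • a‖ ≤ ‖c‖ * ‖a‖ := norm_smul_le c
    exact h a

/-- The canonical homomorphism from `P` to its completion. -/
def of : P →ₐ[ℂ] p.Completion where
  toFun a := ((show p.Carrier from a) : UniformSpace.Completion p.Carrier)
  map_one' := UniformSpace.Completion.coe_one _
  map_mul' a b := UniformSpace.Completion.coe_mul (show p.Carrier from a) b
  map_zero' := UniformSpace.Completion.coe_zero
  map_add' a b := UniformSpace.Completion.coe_add (show p.Carrier from a) b
  commutes' _ := rfl

theorem norm_of (a : P) : ‖p.of a‖ = p a :=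
  UniformSpace.Completion.norm_coe (show p.Carrier from a)

theorem denseRange_of : DenseRange p.of :=
  UniformSpace.Completion.denseRange_coe (α := p.Carrier)

theorem uniformContinuous_star : UniformContinuous (star : p.Carrier → p.Carrier) :=
  star_isometry.uniformContinuous

instance : Star p.Completion where
  star := UniformSpace.Completion.map (star : p.Carrier → p.Carrier)

theorem continuous_star : Continuous (star : p.Completion → p.Completion) :=
  UniformSpace.Completion.continuous_map

theorem star_of (a : P) : star (p.of a) = p.of (star a) :=
  UniformSpace.Completion.map_coe p.uniformContinuous_star (show p.Carrier from a)

instance : StarRing p.Completion where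
  star_involutive a := by
    refine p.denseRange_of.induction_on (p := fun a => star (star a) = a) a ?_ ?_
    · exact isClosed_eq (p.continuous_star.comp p.continuous_star) continuous_id
    · intro a
      simp only [star_of, star_star]
  star_mul a b := by
    refine p.denseRange_of.induction_on₂ (p := fun a b => star (a * b) = star b * star a) ?_ ?_ a b
    · exact isClosed_eq (p.continuous_star.comp (by fun_prop))
        ((p.continuous_star.comp continuous_snd).mul (p.continuous_star.comp continuous_fst))
    · intro a b
      simp only [star_of, ← map_mul, star_mul]
  star_add a b := by
    refine p.denseRange_of.induction_on₂ (p := fun a b => star (a + b) = star a + star b) ?_ ?_ a b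
    · exact isClosed_eq (p.continuous_star.comp (by fun_prop))
        ((p.continuous_star.comp continuous_fst).add (p.continuous_star.comp continuous_snd))
    · intro a b
      simp only [star_of, ← map_add, star_add]

instance [StarModule ℂ P] : CStarAlgebra p.Completion where
  norm_mul_self_le a := by
    refine p.denseRange_of.induction_on (p := fun a => ‖a‖ * ‖a‖ ≤ ‖star a * a‖) a ?_ ?_
    · exact isClosed_le (continuous_norm.mul continuous_norm)
        (continuous_norm.comp (p.continuous_star.mul continuous_id))
    · intro a
      rw [star_of, ← map_mul, norm_of, norm_of, star_mul_self]
  star_smul c a := by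
    refine p.denseRange_of.induction_on (p := fun a => star (c • a) = star c • star a) a ?_ ?_
    · exact isClosed_eq (p.continuous_star.comp (continuous_const_smul c))
        (p.continuous_star.const_smul (star c))
    · intro a
      simp only [star_of, ← map_smul, star_smul]

end CStarSeminorm

/-! ### Universal C*-algebras -/

section Universal

variable {ι : Type}

/-- The C*-seminorms on the free `*`-algebra for which the relations `r = 0`, `r ∈ R`, hold. -/
def AdmissibleSeminorm (R : Set (FreeStarAlgebra ι)) : Type :=
  {p : CStarSeminorm (FreeStarAlgebra ι) // ∀ r ∈ R, p r = 0}

/-- The relations bound the norm of each generator, which is exactly the condition under which the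
universal C*-algebra of the relations exists. -/
class BoundedRelations (R : Set (FreeStarAlgebra ι)) : Prop where
  bounded : ∀ i, ∃ C : ℝ, ∀ p : AdmissibleSeminorm R, p.1 (FreeStarAlgebra.gen i) ≤ C

variable (R : Set (FreeStarAlgebra ι))

instance : Nonempty (AdmissibleSeminorm R) :=
  ⟨⟨{ (0 : Seminorm ℂ (FreeStarAlgebra ι)) with
      mul_le' := fun _ _ => (mul_zero (0 : ℝ)).ge
      star_mul_self' := fun _ => (mul_zero (0 : ℝ)).symm }, fun _ _ => rfl⟩⟩

theorem bddAbove_admissible [BoundedRelations R] (a : FreeStarAlgebra ι) :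
    BddAbove (Set.range fun p : AdmissibleSeminorm R => p.1 a) := by
  suffices h : ∃ C : ℝ, ∀ p : AdmissibleSeminorm R, p.1 a ≤ C by
    obtain ⟨C, hC⟩ := h
    exact ⟨C, by rintro _ ⟨p, rfl⟩; exact hC p⟩
  induction a using FreeStarAlgebra.induction with
  | algebraMap c =>
    refine ⟨‖c‖, fun p => ?_⟩
    rw [Algebra.algebraMap_eq_smul_one, map_smul_eq_mul p.1.toSeminorm]
    exact mul_le_of_le_one_right (norm_nonneg c) p.1.one_le_one
  | gen i => exact BoundedRelations.bounded i
  | star_gen i =>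
    obtain ⟨C, hC⟩ := BoundedRelations.bounded (R := R) i
    exact ⟨C, fun p => (p.1.star_eq _).trans_le (hC p)⟩
  | mul a b ha hb =>
    obtain ⟨C, hC⟩ := ha
    obtain ⟨D, hD⟩ := hb
    exact ⟨C * D, fun p => (p.1.mul_le a b).trans
      (mul_le_mul (hC p) (hD p) (p.1.nonneg b) ((p.1.nonneg a).trans (hC p)))⟩
  | add a b ha hb =>
    obtain ⟨C, hC⟩ := ha
    obtain ⟨D, hD⟩ := hb
    exact ⟨C + D, fun p => (map_add_le_add p.1.toSeminorm a b).trans (add_le_add (hC p) (hD p))⟩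

/-- The largest C*-seminorm on the free `*`-algebra for which the relations `R` hold. -/
def maxSeminorm [BoundedRelations R] : CStarSeminorm (FreeStarAlgebra ι) where
  toFun a := ⨆ p : AdmissibleSeminorm R, p.1 a
  map_zero' := by simp
  add_le' a b := ciSup_le fun p => (map_add_le_add p.1.toSeminorm a b).trans
    (add_le_add (le_ciSup (bddAbove_admissible R a) p) (le_ciSup (bddAbove_admissible R b) p))
  neg' a := by simp
  smul' c a := by
    simp only [map_smul_eq_mul]
    exact (Real.mul_iSup_of_nonneg (norm_nonneg c) _).symm
  mul_le' a b := ciSup_le fun p => (p.1.mul_le a b).trans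
    (mul_le_mul (le_ciSup (bddAbove_admissible R a) p) (le_ciSup (bddAbove_admissible R b) p)
      (p.1.nonneg b) (Real.iSup_nonneg fun p => p.1.nonneg a))
  star_mul_self' a := by
    have h0 : 0 ≤ ⨆ p : AdmissibleSeminorm R, p.1 a := Real.iSup_nonneg fun p => p.1.nonneg a
    apply le_antisymm
    · refine ciSup_le fun p => (p.1.star_mul_self a).trans_le ?_
      have h := le_ciSup (bddAbove_admissible R a) p
      exact mul_le_mul h h (p.1.nonneg a) h0
    · rw [Real.mul_iSup_of_nonneg h0]
      refine ciSup_le fun p => ?_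
      rw [Real.iSup_mul_of_nonneg (p.1.nonneg a)]
      refine ciSup_le fun q => ?_
      have key : ∀ r : AdmissibleSeminorm R, r.1 a * r.1 a ≤
          ⨆ p : AdmissibleSeminorm R, p.1 (star a * a) := fun r =>
        (r.1.star_mul_self a).symm.trans_le (le_ciSup (bddAbove_admissible R (star a * a)) r)
      have hp := p.1.nonneg a
      have hq := q.1.nonneg a
      rcases le_total (p.1 a) (q.1 a) with h | h
      · exact (mul_le_mul_of_nonneg_left h hq).trans (key q)
      · exact (mul_le_mul_of_nonneg_right h hp).trans (key p)

/-- The universal unital C*-algebra on generators indexed by `ι` subject to the relations `r = 0`,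
`r ∈ R`: the completion of the free `*`-algebra in the largest C*-seminorm for which the relations
hold. -/
def UniversalCStar [BoundedRelations R] : Type := (maxSeminorm R).Completion

instance [BoundedRelations R] : CStarAlgebra (UniversalCStar R) :=
  inferInstanceAs (CStarAlgebra (maxSeminorm R).Completion)

/-- The generator with index `i` of the universal C*-algebra. -/
def UniversalCStar.gen [BoundedRelations R] (i : ι) : UniversalCStar R :=
  (maxSeminorm R).of (FreeStarAlgebra.gen i)

end Universal

/-! ### Noncommutative tori and even-dimensional spheres -/

section Spheres

open FreeStarAlgebra

variable {m : ℕ} (θ : Matrix (Fin m) (Fin m) ℝ)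

/-- `ρ i j = exp (2 π i θ i j)`. -/
def rho (i j : Fin m) : ℂ := Complex.exp (2 * Real.pi * Complex.I * θ i j)

/-- The relations of the noncommutative torus: each `U i` is unitary and
`U i * U j = ρ j i • U j * U i`. -/
def torusRelations : Set (FreeStarAlgebra (Fin m)) :=
  {r | (∃ i, r = star (gen i) * gen i - 1) ∨ (∃ i, r = gen i * star (gen i) - 1) ∨
    ∃ i j, r = gen i * gen j - rho θ j i • (gen j * gen i)}

/-- The generators `z 1, …, z m` of the even-dimensional sphere in the free `*`-algebra. -/
def freeZ (i : Fin m) : FreeStarAlgebra (Option (Fin m)) := gen (some i)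

/-- The generator `x` of the even-dimensional sphere in the free `*`-algebra. -/
def freeX (m : ℕ) : FreeStarAlgebra (Option (Fin m)) := gen none

/-- The relations of the `θ`-deformed `2m`-sphere: each `z i` is normal, `x` is self-adjoint,
`∑ i, z i * star (z i) + x ^ 2 = 1`, `z i * z j = ρ j i • z j * z i`, and `x` commutes with each
`z i`. -/
def evenSphereRelations : Set (FreeStarAlgebra (Option (Fin m))) :=
  {r | (∃ i : Fin m, r = star (freeZ i) * freeZ i - freeZ i * star (freeZ i)) ∨
    r = star (freeX m) - freeX m ∨
    r = ∑ i : Fin m, freeZ i * star (freeZ i) + freeX m ^ 2 - 1 ∨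
    (∃ i j : Fin m, r = freeZ i * freeZ j - rho θ j i • (freeZ j * freeZ i)) ∨
    ∃ i : Fin m, r = freeX m * freeZ i - freeZ i * freeX m}

instance : BoundedRelations (torusRelations θ) where
  bounded i := by
    refine ⟨1, fun p => ?_⟩
    have h1 : p.1 (star (gen i) * gen i - 1) = 0 := p.2 _ (Or.inl ⟨i, rfl⟩)
    have h2 : p.1 (star (gen i) * gen i) ≤ 1 := by
      have := map_add_le_add p.1.toSeminorm (star (gen i) * gen i - 1) 1
      rw [sub_add_cancel] at this
      linarith [p.1.one_le_one]
    rw [p.1.star_mul_self] at h2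
    nlinarith [p.1.nonneg (gen i)]

instance : BoundedRelations (evenSphereRelations θ) where
  bounded := by
    open scoped CStarAlgebra in
    suffices h : ∀ (p : AdmissibleSeminorm (evenSphereRelations θ)) (i : Option (Fin m)),
        p.1 (gen i) ≤ 1 from fun i => ⟨1, fun p => h p i⟩
    intro p
    let _ : PartialOrder p.1.Completion := CStarAlgebra.spectralOrder _
    have _ : StarOrderedRing p.1.Completion := CStarAlgebra.spectralOrderedRing _
    have hof : ∀ a, p.1 a = 0 → p.1.of a = 0 := fun a ha => by
      rw [← norm_eq_zero, p.1.norm_of, ha]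
    set z : Fin m → p.1.Completion := fun i => p.1.of (freeZ i) with hz
    set x : p.1.Completion := p.1.of (freeX m) with hx
    have hx0 : star x = x := by
      have := hof _ (p.2 (star (freeX m) - freeX m) (Or.inr (Or.inl rfl)))
      rw [map_sub, ← p.1.star_of, sub_eq_zero] at this
      exact this
    have hs : ∑ i, z i * star (z i) + x * star x = 1 := by
      have := hof _ (p.2 (∑ i : Fin m, freeZ i * star (freeZ i) + freeX m ^ 2 - 1)
        (Or.inr (Or.inr (Or.inl rfl))))
      rw [map_sub, map_add, map_sum, map_one, map_pow, sub_eq_zero] at this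
      simp only [map_mul, ← p.1.star_of] at this
      rw [hx0, ← sq]
      exact this
    have key : ∀ (g : FreeStarAlgebra (Option (Fin m))),
        p.1.of g * star (p.1.of g) ≤ 1 → p.1 g ≤ 1 := fun g hg => by
      have h1 : ‖p.1.of g * star (p.1.of g)‖ ≤ ‖(1 : p.1.Completion)‖ :=
        CStarAlgebra.norm_le_norm_of_nonneg_of_le (mul_star_self_nonneg _) hg
      rw [CStarRing.norm_self_mul_star, p.1.norm_of, ← map_one p.1.of, p.1.norm_of] at h1
      have := p.1.one_le_one
      nlinarith [p.1.nonneg g]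
    have hsum : 0 ≤ ∑ i, z i * star (z i) :=
      Finset.sum_nonneg fun i _ => mul_star_self_nonneg _
    rintro (_ | i)
    · refine key _ ?_
      rw [← hs]
      exact le_add_of_nonneg_left hsum
    · refine key _ ?_
      rw [← hs]
      have h1 : z i * star (z i) ≤ ∑ i, z i * star (z i) :=
        Finset.single_le_sum (f := fun i => z i * star (z i))
          (fun i _ => mul_star_self_nonneg _) (Finset.mem_univ i)
      exact h1.trans (le_add_of_nonneg_right (mul_star_self_nonneg x))

/-- The noncommutative torus `A_θ`. -/
abbrev NCTorus : Type := UniversalCStar (torusRelations θ)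

/-- The unitary generators of the noncommutative torus. -/
def NCTorus.U (i : Fin m) : NCTorus θ := UniversalCStar.gen (torusRelations θ) i

/-- The `θ`-deformed even sphere `C(S^{2m}_θ)`. -/
abbrev EvenSphere : Type := UniversalCStar (evenSphereRelations θ)

/-- The normal generators of the `θ`-deformed even sphere. -/
def EvenSphere.z (i : Fin m) : EvenSphere θ :=
  UniversalCStar.gen (evenSphereRelations θ) (some i)

/-- The self-adjoint generator of the `θ`-deformed even sphere. -/
def EvenSphere.x : EvenSphere θ := UniversalCStar.gen (evenSphereRelations θ) none

/-- The C*-subalgebra `A_θ(i)` of the noncommutative torus generated by all `U j` with `j ≠ i`. -/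
def NCTorus.withoutGen (i : Fin m) : StarSubalgebra ℂ (NCTorus θ) :=
  (StarAlgebra.adjoin ℂ {u | ∃ j, j ≠ i ∧ u = NCTorus.U θ j}).topologicalClosure

/-- The part of the unit sphere of `ℝ^(m+1)` on which the first `m` coordinates are
nonnegative. -/
def partialOctant (m : ℕ) : Set (EuclideanSpace ℝ (Fin (m + 1))) :=
  {t | ‖t‖ = 1 ∧ ∀ k : Fin m, 0 ≤ t k.castSucc}

instance (m : ℕ) : CompactSpace (partialOctant m) := by
  rw [← isCompact_iff_compactSpace]
  have h : ∀ k : Fin m, IsClosed {t : EuclideanSpace ℝ (Fin (m + 1)) | 0 ≤ t k.castSucc} :=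
    fun k => isClosed_le continuous_const (by fun_prop)
  have h' : partialOctant m =
      Metric.sphere 0 1 ∩ ⋂ k : Fin m, {t | 0 ≤ t k.castSucc} := by
    ext t
    simp [partialOctant]
  rw [h']
  exact (isCompact_sphere _ _).inter_right (isClosed_iInter h)

/-- The C*-algebra of continuous functions from the partial octant to the noncommutative torus
that map the face `t i = 0` into `A_θ(i)` for each `i ≤ m`. -/
def torusField : StarSubalgebra ℂ C(partialOctant m, NCTorus θ) where
  carrier := {f | ∀ (i : Fin m) (t : partialOctant m), t.1 i.castSucc = 0 →
    f t ∈ NCTorus.withoutGen θ i}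
  mul_mem' hf hg i t ht := mul_mem (hf i t ht) (hg i t ht)
  add_mem' hf hg i t ht := add_mem (hf i t ht) (hg i t ht)
  algebraMap_mem' c i _ _ := algebraMap_mem (NCTorus.withoutGen θ i) c
  star_mem' hf i t ht := star_mem (hf i t ht)

end Spheres

end

/-! ### The universal property of universal C*-algebras -/

/-! The functions `t ↦ t_i U_i` and `t ↦ t_{m+1}` satisfy the sphere relations pointwise, so the
universal property gives a homomorphism `sphereToField`. Its image lies in the field because `t_i
U_i` vanishes on the face `t_i = 0`. Bijectivity remains, and both halves rest on the gauge action
of the torus, which multiplies `z_i`, respectively `U_i`, by `exp(2πi s_i)`. The Fourier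
coefficients of the orbit of an element are its components of weight `n ∈ ℤ^m`, and a closed
subspace that contains all components contains the element (`mem_of_torusCoeff_mem`). By the
Fuglede–Putnam theorem the generators also commute up to phases with each other's adjoints. Hence
the component of weight `n` lies in the closure of `C z^n`, where `z^n` is an ordered monomial and
`C` is the commutative algebra generated by `x` and the `z_i z_i^*`.

Injectivity (`injective_sphereToField`): the map is equivariant, so each component `y` of an element
of the kernel is in the kernel, and `y^* y` lies in the closure of `C`. Characters of this closure
come from points of the octant: `t_i` is the nonnegative root of the value at `z_i z_i^*`, and
`t_{m+1}` is the value at `x`. Gelfand duality then shows that the kernel meets the closure of `C`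
only in `0`, provided `A_θ ≠ 0`; a representation on `ℓ²(ℤ^m)` guarantees this
(`nontrivial_ncTorus`).

Surjectivity (`torusField_le_range`): an injective homomorphism has closed range, and by
Stone–Weierstrass the range contains all scalar functions. A component of a member of the field is
`g U^n` with `g` scalar, and the face conditions make `g` vanish at the zeros of `∏ t_i^|n_i|`. So
`g` is a uniform limit of functions `h ∏ t_i^|n_i|`, and `h ∏ t_i^|n_i| U^n` is the scalar function
`h` times the image of `z^n`. -/

section UniversalProperty

namespace FreeStarAlgebra

variable {ι : Type} {B : Type*} [CStarAlgebra B]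

/-- The algebra homomorphism underlying `FreeStarAlgebra.lift`. -/
noncomputable def liftAlgHom (f : ι → B) : FreeStarAlgebra ι →ₐ[ℂ] B :=
  FreeAlgebra.lift ℂ (Sum.elim f fun i => star (f i))

theorem liftAlgHom_gen (f : ι → B) (i : ι) : liftAlgHom f (gen i) = f i :=
  FreeAlgebra.lift_ι_apply (R := ℂ) (Sum.elim f fun i => star (f i)) (Sum.inl i)

theorem liftAlgHom_star_gen (f : ι → B) (i : ι) : liftAlgHom f (star (gen i)) = star (f i) := by
  rw [star_gen]
  exact FreeAlgebra.lift_ι_apply (R := ℂ) (Sum.elim f fun i => star (f i)) (Sum.inr i)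

/-- The `*`-homomorphism out of the free `*`-algebra with prescribed values on the generators. -/
noncomputable def lift (f : ι → B) : FreeStarAlgebra ι →⋆ₐ[ℂ] B where
  __ := liftAlgHom f
  map_star' a := by
    change liftAlgHom f (star a) = star (liftAlgHom f a)
    induction a using FreeStarAlgebra.induction with
    | algebraMap c =>
      rw [← algebraMap_star_comm, AlgHom.commutes, AlgHom.commutes, algebraMap_star_comm]
    | gen i => rw [liftAlgHom_star_gen, liftAlgHom_gen]
    | star_gen i => rw [star_star, liftAlgHom_star_gen, liftAlgHom_gen, star_star]
    | mul a b ha hb => rw [star_mul, map_mul, map_mul, star_mul, ha, hb]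
    | add a b ha hb => rw [star_add, map_add, map_add, star_add, ha, hb]

@[simp]
theorem lift_gen (f : ι → B) (i : ι) : lift f (gen i) = f i := liftAlgHom_gen f i

end FreeStarAlgebra

namespace CStarSeminorm

/-- The C*-seminorm obtained by pulling back the norm of a C*-algebra. -/
def comapNorm {P : Type} [Ring P] [StarRing P] [Algebra ℂ P] {B : Type*} [CStarAlgebra B]
    (g : P →⋆ₐ[ℂ] B) : CStarSeminorm P where
  toFun a := ‖g a‖
  map_zero' := by simp
  add_le' a b := by rw [map_add]; exact norm_add_le _ _
  neg' a := by simp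
  smul' c a := by rw [map_smul, norm_smul]
  mul_le' a b := by rw [map_mul]; exact norm_mul_le _ _
  star_mul_self' a := by rw [map_mul, map_star]; exact CStarRing.norm_star_mul_self

variable {P : Type} [Ring P] [StarRing P] [Algebra ℂ P] {B : Type*} [CStarAlgebra B]
  (p : CStarSeminorm P) (g : P →⋆ₐ[ℂ] B) (hg : ∀ a, ‖g a‖ ≤ p a)

/-- The continuous extension to the completion of a `*`-homomorphism bounded by `p`. -/
noncomputable def extendFun (_hg : ∀ a, ‖g a‖ ≤ p a) : p.Completion → B :=
  UniformSpace.Completion.extension (α := p.Carrier) (β := B) (fun a => g a)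

include hg in
theorem uniformContinuous_of_norm_le :
    UniformContinuous (fun a : p.Carrier => (g a : B)) := by
  have : LipschitzWith 1 (fun a : p.Carrier => (g a : B)) :=
    LipschitzWith.of_dist_le_mul fun a b => by
      rw [dist_eq_norm, dist_eq_norm, NNReal.coe_one, one_mul]
      exact (congrArg norm (map_sub g a b)).symm.trans_le (hg _)
  exact this.uniformContinuous

theorem extendFun_of (a : P) : p.extendFun g hg (p.of a) = g a :=
  UniformSpace.Completion.extension_coe (p.uniformContinuous_of_norm_le g hg) (show p.Carrier from a)

theorem continuous_extendFun : Continuous (p.extendFun g hg) :=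
  UniformSpace.Completion.continuous_extension

/-- The extension to the completion of a `*`-homomorphism bounded by `p`. -/
noncomputable def extend : p.Completion →⋆ₐ[ℂ] B where
  toFun := p.extendFun g hg
  map_one' := by rw [← map_one p.of, extendFun_of, map_one]
  map_zero' := by rw [← map_zero p.of, extendFun_of, map_zero]
  map_mul' a b := by
    have h := p.continuous_extendFun g hg
    refine p.denseRange_of.induction_on₂
      (p := fun a b => p.extendFun g hg (a * b) = p.extendFun g hg a * p.extendFun g hg b) ?_ ?_ a b
    · exact isClosed_eq (h.comp (by fun_prop)) ((h.comp continuous_fst).mul (h.comp continuous_snd))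
    · intro a b
      rw [← map_mul, extendFun_of, extendFun_of, extendFun_of, map_mul]
  map_add' a b := by
    have h := p.continuous_extendFun g hg
    refine p.denseRange_of.induction_on₂
      (p := fun a b => p.extendFun g hg (a + b) = p.extendFun g hg a + p.extendFun g hg b) ?_ ?_ a b
    · exact isClosed_eq (h.comp (by fun_prop)) ((h.comp continuous_fst).add (h.comp continuous_snd))
    · intro a b
      rw [← map_add, extendFun_of, extendFun_of, extendFun_of, map_add]
  commutes' c := by rw [← AlgHom.commutes p.of, extendFun_of]; exact AlgHomClass.commutes g c
  map_star' a := by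
    have h := p.continuous_extendFun g hg
    refine p.denseRange_of.induction_on
      (p := fun a => p.extendFun g hg (star a) = star (p.extendFun g hg a)) a ?_ ?_
    · exact isClosed_eq (h.comp p.continuous_star) h.star
    · intro a
      rw [star_of, extendFun_of, extendFun_of, map_star]

theorem extend_of (a : P) : p.extend g hg (p.of a) = g a := p.extendFun_of g hg a

end CStarSeminorm

namespace UniversalCStar

variable {ι : Type} (R : Set (FreeStarAlgebra ι)) [BoundedRelations R]

theorem of_eq_zero {r : FreeStarAlgebra ι} (hr : r ∈ R) : (maxSeminorm R).of r = 0 := by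
  rw [← norm_eq_zero, CStarSeminorm.norm_of]
  change ⨆ p : AdmissibleSeminorm R, p.1 r = 0
  simp [fun p : AdmissibleSeminorm R => p.2 r hr]

theorem star_gen (i : ι) :
    star (gen R i) = (maxSeminorm R).of (star (FreeStarAlgebra.gen i)) :=
  CStarSeminorm.star_of _ _

/-- The universal property of the universal C*-algebra. -/
noncomputable def lift {B : Type*} [CStarAlgebra B] (f : ι → B)
    (hf : ∀ r ∈ R, FreeStarAlgebra.lift f r = 0) : UniversalCStar R →⋆ₐ[ℂ] B :=
  (maxSeminorm R).extend (FreeStarAlgebra.lift f) fun a =>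
    -- The pulled-back norm is itself an admissible seminorm, hence is dominated by the supremum.
    le_ciSup (bddAbove_admissible R a) (⟨CStarSeminorm.comapNorm (FreeStarAlgebra.lift f),
      fun r hr => by
        change ‖FreeStarAlgebra.lift f r‖ = 0
        rw [hf r hr, norm_zero]⟩ : AdmissibleSeminorm R)

theorem lift_gen {B : Type*} [CStarAlgebra B] (f : ι → B)
    (hf : ∀ r ∈ R, FreeStarAlgebra.lift f r = 0) (i : ι) : lift R f hf (gen R i) = f i :=
  ((maxSeminorm R).extend_of _ _ _).trans (FreeStarAlgebra.lift_gen f i)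

theorem adjoin_gen_closure :
    (StarAlgebra.adjoin ℂ (Set.range (gen R))).topologicalClosure = ⊤ := by
  rw [StarSubalgebra.eq_top_iff]
  intro a
  rw [← SetLike.mem_coe, StarSubalgebra.topologicalClosure_coe]
  refine closure_mono ?_ ((maxSeminorm R).denseRange_of a)
  rintro _ ⟨b, rfl⟩
  change (maxSeminorm R).of b ∈ StarAlgebra.adjoin ℂ (Set.range (gen R))
  have hg : ∀ i, gen R i ∈ StarAlgebra.adjoin ℂ (Set.range (gen R)) := fun i =>
    StarAlgebra.subset_adjoin ℂ _ ⟨i, rfl⟩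
  induction b using FreeStarAlgebra.induction with
  | algebraMap c =>
    rw [AlgHom.commutes]
    exact algebraMap_mem (StarAlgebra.adjoin ℂ (Set.range (gen R))) c
  | gen i => exact hg i
  | star_gen i =>
    have := star_mem (hg i)
    rwa [star_gen] at this
  | mul a b ha hb => rw [map_mul]; exact mul_mem ha hb
  | add a b ha hb => rw [map_add]; exact add_mem ha hb

/-- A closed `*`-subalgebra that contains the generators is everything. -/
theorem mem_of_gen_mem {S : StarSubalgebra ℂ (UniversalCStar R)}
    (hS : IsClosed (S : Set (UniversalCStar R))) (h : ∀ i, gen R i ∈ S) (a : UniversalCStar R) :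
    a ∈ S := by
  have h1 : StarAlgebra.adjoin ℂ (Set.range (gen R)) ≤ S :=
    StarAlgebra.adjoin_le (by rintro _ ⟨i, rfl⟩; exact h i)
  have h2 := StarSubalgebra.topologicalClosure_minimal h1 hS
  rw [adjoin_gen_closure] at h2
  exact h2 StarSubalgebra.mem_top

open scoped CStarAlgebra in
theorem hom_ext {B : Type*} [CStarAlgebra B] {f g : UniversalCStar R →⋆ₐ[ℂ] B}
    (h : ∀ i, f (gen R i) = g (gen R i)) (a : UniversalCStar R) : f a = g a :=
  mem_of_gen_mem R (S := StarAlgHom.equalizer f g)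
    (isClosed_eq (map_continuous f) (map_continuous g)) h a

end UniversalCStar

end UniversalProperty

/-! ### Weighted shifts and the nontriviality of noncommutative tori -/

section WeightedShift

open scoped ENNReal

/-- The weighted composition operator `f ↦ (n ↦ u n * f (σ n))` on square-summable families. -/
noncomputable def weightedShiftLI {κ : Type} (σ : κ ≃ κ) (u : κ → ℂ) (hu : ∀ n, ‖u n‖ = 1) :
    lp (fun _ : κ => ℂ) 2 →ₗᵢ[ℂ] lp (fun _ : κ => ℂ) 2 where
  toFun f := ⟨fun n => u n * f (σ n), by
    have h := (lp.memℓp f).summable (by norm_num)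
    refine memℓp_gen ?_
    simp only [norm_mul, hu, one_mul]
    exact (σ.summable_iff (f := fun n => ‖f n‖ ^ (2 : ℝ≥0∞).toReal)).mpr h⟩
  map_add' f g := by ext n; exact mul_add _ _ _
  map_smul' c f := by ext n; exact mul_left_comm _ _ _
  norm_map' f := by
    have h2 : 0 < (2 : ℝ≥0∞).toReal := by norm_num
    rw [lp.norm_eq_tsum_rpow h2, lp.norm_eq_tsum_rpow h2]
    congr 1
    change ∑' n, ‖u n * f (σ n)‖ ^ (2 : ℝ≥0∞).toReal = _
    simp only [norm_mul, hu, one_mul]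
    exact σ.tsum_eq fun n => ‖f n‖ ^ (2 : ℝ≥0∞).toReal

theorem weightedShiftLI_apply {κ : Type} (σ : κ ≃ κ) (u : κ → ℂ) (hu : ∀ n, ‖u n‖ = 1)
    (f : lp (fun _ : κ => ℂ) 2) (n : κ) : weightedShiftLI σ u hu f n = u n * f (σ n) := rfl

/-- The unitary weighted composition operator `f ↦ (n ↦ u n * f (σ n))`. -/
noncomputable def weightedShift {κ : Type} (σ : κ ≃ κ) (u : κ → ℂ) (hu : ∀ n, ‖u n‖ = 1) :
    lp (fun _ : κ => ℂ) 2 ≃ₗᵢ[ℂ] lp (fun _ : κ => ℂ) 2 :=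
  LinearIsometryEquiv.ofSurjective (weightedShiftLI σ u hu) fun f => by
    refine ⟨weightedShiftLI σ.symm (fun n => (u (σ.symm n))⁻¹) (fun n => by simp [hu]) f, ?_⟩
    ext n
    have : u n ≠ 0 := norm_ne_zero_iff.mp (by simp [hu])
    simp [weightedShiftLI_apply, this]

end WeightedShift

/-! ### Noncommutative tori and their representation on `ℓ²(ℤ^m)` -/

section Torus

open FreeStarAlgebra

variable {m : ℕ} {θ : Matrix (Fin m) (Fin m) ℝ}

theorem skew_apply (hθ : θ.transpose = -θ) (i j : Fin m) : θ j i = -θ i j :=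
  congrFun (congrFun hθ i) j

theorem norm_rho (θ : Matrix (Fin m) (Fin m) ℝ) (i j : Fin m) : ‖rho θ i j‖ = 1 := by
  have : rho θ i j = Complex.exp ((2 * Real.pi * θ i j : ℝ) * Complex.I) := by
    rw [rho]; push_cast; ring_nf
  rw [this, Complex.norm_exp_ofReal_mul_I]

theorem rho_ne_zero (θ : Matrix (Fin m) (Fin m) ℝ) (i j : Fin m) : rho θ i j ≠ 0 :=
  Complex.exp_ne_zero _

/-- The relations of the noncommutative torus, in a C*-algebra. -/
structure IsTorusFamily (θ : Matrix (Fin m) (Fin m) ℝ) {B : Type*} [CStarAlgebra B]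
    (u : Fin m → B) : Prop where
  star_mul : ∀ i, star (u i) * u i = 1
  mul_star : ∀ i, u i * star (u i) = 1
  comm : ∀ i j, u i * u j = rho θ j i • (u j * u i)

theorem IsTorusFamily.lift_eq_zero {B : Type*} [CStarAlgebra B] {u : Fin m → B}
    (hu : IsTorusFamily θ u) : ∀ r ∈ torusRelations θ, FreeStarAlgebra.lift u r = 0 := by
  rintro r (⟨i, rfl⟩ | ⟨i, rfl⟩ | ⟨i, j, rfl⟩)
  · simp [hu.star_mul, map_star]
  · simp [hu.mul_star, map_star]
  · simp [hu.comm i j]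

theorem isTorusFamily_U (θ : Matrix (Fin m) (Fin m) ℝ) : IsTorusFamily θ (NCTorus.U θ) where
  star_mul i := by
    have := UniversalCStar.of_eq_zero (torusRelations θ) (Or.inl ⟨i, rfl⟩)
    rwa [map_sub, map_mul, map_one, ← UniversalCStar.star_gen, sub_eq_zero] at this
  mul_star i := by
    have := UniversalCStar.of_eq_zero (torusRelations θ) (Or.inr (Or.inl ⟨i, rfl⟩))
    rwa [map_sub, map_mul, map_one, ← UniversalCStar.star_gen, sub_eq_zero] at this
  comm i j := by
    have := UniversalCStar.of_eq_zero (torusRelations θ) (Or.inr (Or.inr ⟨i, j, rfl⟩))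
    rwa [map_sub, map_smul, map_mul, map_mul, sub_eq_zero] at this

/-- The phase of the `i`-th weighted shift on `ℓ²(ℤ^m)`. -/
noncomputable def torusPhase (θ : Matrix (Fin m) (Fin m) ℝ) (i : Fin m) (n : Fin m → ℤ) : ℂ :=
  Complex.exp ((Real.pi * ∑ k, θ k i * n k : ℝ) * Complex.I)

theorem norm_torusPhase (i : Fin m) (n : Fin m → ℤ) : ‖torusPhase θ i n‖ = 1 :=
  Complex.norm_exp_ofReal_mul_I _

theorem torusPhase_sub (i j : Fin m) (n : Fin m → ℤ) :
    torusPhase θ i (n - Pi.single j 1) =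
      torusPhase θ i n * Complex.exp (-(Real.pi * θ j i : ℝ) * Complex.I) := by
  rw [torusPhase, torusPhase, ← Complex.exp_add]
  congr 1
  have : ∑ k, θ k i * ((n - Pi.single j 1 : Fin m → ℤ) k : ℝ) = ∑ k, θ k i * n k - θ j i := by
    simp [mul_sub, Finset.sum_sub_distrib, Pi.single_apply]
  rw [this]
  push_cast
  ring

/-- The weighted shifts on `ℓ²(ℤ^m)` that represent the noncommutative torus. -/
noncomputable def torusShift (θ : Matrix (Fin m) (Fin m) ℝ) (i : Fin m) :
    unitary (lp (fun _ : Fin m → ℤ => ℂ) 2 →L[ℂ] lp (fun _ : Fin m → ℤ => ℂ) 2) :=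
  Unitary.linearIsometryEquiv.symm
    (weightedShift (Equiv.subRight (Pi.single i 1)) (torusPhase θ i) (norm_torusPhase i))

theorem torusShift_apply (i : Fin m) (f : lp (fun _ : Fin m → ℤ => ℂ) 2) (n : Fin m → ℤ) :
    (torusShift θ i : lp (fun _ : Fin m → ℤ => ℂ) 2 →L[ℂ] lp (fun _ : Fin m → ℤ => ℂ) 2) f n =
      torusPhase θ i n * f (n - Pi.single i 1) := rfl

/-- The phases carry `π` rather than `2π`: exchanging the two shifts changes the phase by
`exp(πi(θ_ji - θ_ij))`, which skew-symmetry turns into `exp(2πi θ_ji)`. -/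
theorem isTorusFamily_torusShift (hθ : θ.transpose = -θ) :
    IsTorusFamily θ fun i => (torusShift θ i :
      lp (fun _ : Fin m → ℤ => ℂ) 2 →L[ℂ] lp (fun _ : Fin m → ℤ => ℂ) 2) where
  star_mul i := Unitary.star_mul_self_of_mem (torusShift θ i).2
  mul_star i := Unitary.mul_star_self_of_mem (torusShift θ i).2
  comm i j := by
    ext f n
    simp only [mul_apply_eq_comp, smul_apply, lp.coeFn_smul,
      Pi.smul_apply, smul_eq_mul, torusShift_apply, torusPhase_sub]
    have h : Complex.exp (-(Real.pi * θ i j : ℝ) * Complex.I) =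
        rho θ j i * Complex.exp (-(Real.pi * θ j i : ℝ) * Complex.I) := by
      rw [rho, ← Complex.exp_add, skew_apply hθ i j]
      congr 1
      push_cast
      ring
    rw [h, sub_right_comm n]
    ring

/-- Skew-symmetry matters here: if some `ρ_ii ≠ 1`, the relations force `U_i ^ 2 = 0` and the
algebra collapses. Nontriviality makes the embedding of the scalars faithful, which both injectivity
and surjectivity need. -/
theorem nontrivial_ncTorus (hθ : θ.transpose = -θ) : Nontrivial (NCTorus θ) := by
  have : Nontrivial (lp (fun _ : Fin m → ℤ => ℂ) 2) :=
    ⟨⟨lp.single 2 0 (1 : ℂ), 0, fun h => by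
      have h0 := congrFun (congrArg (fun f : lp (fun _ : Fin m → ℤ => ℂ) 2 => ⇑f) h) 0
      simp at h0⟩⟩
  exact (UniversalCStar.lift (torusRelations θ) _
    (isTorusFamily_torusShift hθ).lift_eq_zero).toAlgHom.toRingHom.domain_nontrivial

end Torus

/-! ### Monomials in families that commute up to a phase -/

section PhaseCommute

variable {A : Type*} [Ring A] [Algebra ℂ A]

/-- Commutation up to a nonzero scalar. -/
def PhaseCommute (a b : A) : Prop := ∃ c : ℂ, c ≠ 0 ∧ a * b = c • (b * a)

theorem PhaseCommute.one_right (a : A) : PhaseCommute a 1 := ⟨1, by simp⟩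

theorem PhaseCommute.symm {a b : A} (h : PhaseCommute a b) : PhaseCommute b a := by
  obtain ⟨c, hc, e⟩ := h
  exact ⟨c⁻¹, inv_ne_zero hc, by rw [e, smul_smul, inv_mul_cancel₀ hc, one_smul]⟩

theorem PhaseCommute.mul_right {a b b' : A} (h : PhaseCommute a b) (h' : PhaseCommute a b') :
    PhaseCommute a (b * b') := by
  obtain ⟨c, hc0, hc⟩ := h
  obtain ⟨d, hd0, hd⟩ := h'
  refine ⟨c * d, mul_ne_zero hc0 hd0, ?_⟩
  rw [← mul_assoc, hc, smul_mul_assoc, mul_assoc, hd, mul_smul_comm, smul_smul, mul_assoc]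

theorem PhaseCommute.pow_right {a b : A} (h : PhaseCommute a b) (k : ℕ) :
    PhaseCommute a (b ^ k) := by
  induction k with
  | zero => rw [pow_zero]; exact .one_right a
  | succ k ih => rw [pow_succ]; exact ih.mul_right h

theorem PhaseCommute.star_star [StarRing A] [StarModule ℂ A] {a b : A} (h : PhaseCommute b a) :
    PhaseCommute (star a) (star b) := by
  obtain ⟨c, hc0, hc⟩ := h
  exact ⟨star c, star_ne_zero.mpr hc0, by rw [← star_mul, ← star_mul, hc, star_smul]⟩

end PhaseCommute

/-! ### Integral powers and ordered monomials -/

section StarZPow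

variable {A : Type*} [Ring A] [StarRing A]

/-- Powers of `a` with integral exponents, where the negative ones are powers of `star a`. -/
def starZPow (a : A) : ℤ → A
  | Int.ofNat k => a ^ k
  | Int.negSucc k => star a ^ (k + 1)

@[simp] theorem starZPow_natCast (a : A) (k : ℕ) : starZPow a (k : ℤ) = a ^ k := rfl

@[simp] theorem starZPow_zero (a : A) : starZPow a 0 = 1 := pow_zero a

theorem starZPow_neg_natCast (a : A) (k : ℕ) : starZPow a (-(k : ℤ)) = star a ^ k := by
  cases k with
  | zero => simp
  | succ k => rfl

theorem starZPow_star (a : A) (k : ℤ) : starZPow (star a) k = starZPow a (-k) := by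
  obtain ⟨k, rfl | rfl⟩ := k.eq_nat_or_neg
  · rw [starZPow_natCast, starZPow_neg_natCast]
  · rw [starZPow_neg_natCast, neg_neg, starZPow_natCast, star_star]

theorem PhaseCommute.starZPow_right [Algebra ℂ A] {a b : A} (h : PhaseCommute a b)
    (h' : PhaseCommute a (star b)) (k : ℤ) : PhaseCommute a (starZPow b k) := by
  obtain ⟨k, rfl | rfl⟩ := k.eq_nat_or_neg
  · rw [starZPow_natCast]; exact h.pow_right k
  · rw [starZPow_neg_natCast]; exact h'.pow_right k

/-- For `k ≥ 0` nothing is left over; for `k < 0` one factor `a * star a` splits off and is absorbed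
by `C`. This replaces the cancellation available for unitaries. -/
theorem exists_mul_starZPow [Algebra ℂ A] [StarModule ℂ A] (C : StarSubalgebra ℂ A) {a : A} (ha : a * star a ∈ C) (k : ℤ) :
    ∃ c ∈ C, a * starZPow a k = c * starZPow a (k + 1) := by
  cases k with
  | ofNat k => exact ⟨1, one_mem C, by rw [one_mul]; exact (pow_succ' a k).symm⟩
  | negSucc k =>
    refine ⟨a * star a, ha, ?_⟩
    have h : Int.negSucc k + 1 = -(k : ℤ) := by omega
    rw [h, starZPow_neg_natCast, mul_assoc, ← pow_succ']
    rfl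

/-- The ordered monomial with exponents `n`. -/
def starMonomial {m : ℕ} (z : Fin m → A) (n : Fin m → ℤ) : A :=
  ((List.finRange m).map fun i => starZPow (z i) (n i)).prod

theorem starMonomial_zero {m : ℕ} (z : Fin m → A) : starMonomial z 0 = 1 := by
  refine List.prod_eq_one fun a ha => ?_
  obtain ⟨i, -, rfl⟩ := List.mem_map.mp ha
  exact starZPow_zero _

end StarZPow

/-! ### Algebras spanned by monomials over a commuting subalgebra -/

section Monomials

variable {A : Type*} [Ring A] [StarRing A] [Algebra ℂ A] [StarModule ℂ A]

/-- A family of normal elements that commute up to phases with each other and with their adjoints,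
together with a `*`-subalgebra `C` that commutes with the family and contains the squared absolute
values. -/
structure IsPhaseFamily {m : ℕ} (z : Fin m → A) (C : StarSubalgebra ℂ A) : Prop where
  normal : ∀ i, star (z i) * z i = z i * star (z i)
  mul_star_mem : ∀ i, z i * star (z i) ∈ C
  commute : ∀ c ∈ C, ∀ i, c * z i = z i * c
  phase : ∀ i j, PhaseCommute (z i) (z j)
  phase_star : ∀ i j, PhaseCommute (z i) (star (z j))

namespace IsPhaseFamily

variable {m : ℕ} {z : Fin m → A} {C : StarSubalgebra ℂ A}

theorem commute_star (h : IsPhaseFamily z C) {c : A} (hc : c ∈ C) (i : Fin m) :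
    c * star (z i) = star (z i) * c := by
  have := congrArg star (h.commute _ (star_mem hc) i)
  simpa using this.symm

theorem commute_starZPow (h : IsPhaseFamily z C) {c : A} (hc : c ∈ C) (i : Fin m)
    (k : ℤ) : Commute c (starZPow (z i) k) := by
  obtain ⟨k, rfl | rfl⟩ := k.eq_nat_or_neg
  · rw [starZPow_natCast]
    exact Commute.pow_right (h.commute c hc i) k
  · rw [starZPow_neg_natCast]
    exact Commute.pow_right (h.commute_star hc i) k

theorem commute_starMonomial (h : IsPhaseFamily z C) {c : A} (hc : c ∈ C)
    (n : Fin m → ℤ) : Commute c (starMonomial z n) := by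
  refine Commute.list_prod_right _ _ fun a ha => ?_
  obtain ⟨i, -, rfl⟩ := List.mem_map.mp ha
  exact h.commute_starZPow hc i _

/-- The factor `a` travels right past the letters before `i`, each at the cost of a scalar that is
collected in `c`, and merges with the letter `i`. Since `i` occurs only once, no other exponent
changes. -/
theorem exists_mul_list_prod (h : IsPhaseFamily z C) {a : A} {n : Fin m → ℤ}
    {i : Fin m} {k : ℤ} (ha : ∀ j, PhaseCommute a (starZPow (z j) (n j)))
    (hi : ∃ c ∈ C, a * starZPow (z i) (n i) = c * starZPow (z i) k) (l : List (Fin m))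
    (hl : l.Nodup) (hil : i ∈ l) :
    ∃ c ∈ C, a * (l.map fun j => starZPow (z j) (n j)).prod =
      c * (l.map fun j => starZPow (z j) (Function.update n i k j)).prod := by
  induction l with
  | nil => simp at hil
  | cons j t ih =>
    rw [List.nodup_cons] at hl
    simp only [List.map_cons, List.prod_cons]
    by_cases hj : j = i
    · subst hj
      obtain ⟨c, hc, hci⟩ := hi
      refine ⟨c, hc, ?_⟩
      have ht : t.map (fun l => starZPow (z l) (Function.update n j k l)) =
          t.map fun l => starZPow (z l) (n l) :=
        List.map_congr_left fun l hlt => by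
          rw [Function.update_of_ne (by rintro rfl; exact hl.1 hlt)]
      rw [ht, ← mul_assoc, hci, Function.update_self, mul_assoc]
    · obtain ⟨c, hc, hct⟩ := ih hl.2 ((List.mem_cons.mp hil).resolve_left (Ne.symm hj))
      obtain ⟨d, -, hd⟩ := ha j
      refine ⟨d • c, SMulMemClass.smul_mem d hc, ?_⟩
      rw [← mul_assoc, hd, smul_mul_assoc, mul_assoc, hct, ← mul_assoc,
        ← (h.commute_starZPow hc j (n j)).eq, Function.update_of_ne hj, smul_mul_assoc, mul_assoc]

theorem exists_mul_starMonomial (h : IsPhaseFamily z C) (n : Fin m → ℤ)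
    (i : Fin m) : ∃ c ∈ C, ∃ n', z i * starMonomial z n = c * starMonomial z n' := by
  obtain ⟨c, hc, e⟩ := h.exists_mul_list_prod (n := n) (a := z i)
    (fun j => (h.phase i j).starZPow_right (h.phase_star i j) _)
    (exists_mul_starZPow C (h.mul_star_mem i) (n i)) (List.finRange m) (List.nodup_finRange m)
    (List.mem_finRange i)
  exact ⟨c, hc, _, e⟩

theorem exists_star_mul_starMonomial (h : IsPhaseFamily z C) (n : Fin m → ℤ)
    (i : Fin m) : ∃ c ∈ C, ∃ n', star (z i) * starMonomial z n = c * starMonomial z n' := by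
  have hi : ∃ c ∈ C, star (z i) * starZPow (z i) (n i) = c * starZPow (z i) (n i - 1) := by
    -- A power of `z i` is the opposite power of `star (z i)`, so raising the exponent of the latter
    -- lowers that of the former.
    obtain ⟨c, hc, e⟩ := exists_mul_starZPow C (a := star (z i))
      (by rw [star_star, h.normal]; exact h.mul_star_mem i) (-n i)
    refine ⟨c, hc, ?_⟩
    rw [starZPow_star, starZPow_star, neg_neg] at e
    rw [e]
    congr 2
    ring
  obtain ⟨c, hc, e⟩ := h.exists_mul_list_prod (n := n) (a := star (z i))
    (fun j => PhaseCommute.starZPow_right (h.phase_star j i).symm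
      (h.phase j i).star_star _) hi (List.finRange m) (List.nodup_finRange m) (List.mem_finRange i)
  exact ⟨c, hc, _, e⟩

/-- By normality the absolute square of the outermost letter is a power of `z j * star (z j)`, hence
lies in `C` and can be moved past the remaining letters. -/
theorem star_mul_self_list_prod_mem (h : IsPhaseFamily z C) (n : Fin m → ℤ)
    (l : List (Fin m)) : star (l.map fun j => starZPow (z j) (n j)).prod *
      (l.map fun j => starZPow (z j) (n j)).prod ∈ C := by
  induction l with
  | nil => simp
  | cons j t ih =>
    have hj : star (starZPow (z j) (n j)) * starZPow (z j) (n j) ∈ C := by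
      have hcomm : Commute (star (z j)) (z j) := h.normal j
      obtain ⟨k, e | e⟩ := (n j).eq_nat_or_neg
      · rw [e, starZPow_natCast, star_pow, ← hcomm.mul_pow, h.normal]
        exact pow_mem (h.mul_star_mem j) k
      · rw [e, starZPow_neg_natCast, star_pow, star_star, ← hcomm.symm.mul_pow]
        exact pow_mem (h.mul_star_mem j) k
    have hcomm : Commute (star (starZPow (z j) (n j)) * starZPow (z j) (n j))
        (t.map fun j => starZPow (z j) (n j)).prod := by
      refine Commute.list_prod_right _ _ fun a ha => ?_
      obtain ⟨i, -, rfl⟩ := List.mem_map.mp ha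
      exact h.commute_starZPow hj i _
    simp only [List.map_cons, List.prod_cons, star_mul]
    rw [mul_assoc, ← mul_assoc (star (starZPow (z j) (n j))), hcomm.eq, ← mul_assoc]
    exact mul_mem ih hj

theorem star_mul_self_starMonomial_mem (h : IsPhaseFamily z C) (n : Fin m → ℤ) :
    star (starMonomial z n) * starMonomial z n ∈ C :=
  h.star_mul_self_list_prod_mem n _

/-- The elements `c * starMonomial z n` with `c ∈ C` span every `*`-algebra generated by the family
and by elements of `C`. -/
theorem adjoin_le_span (h : IsPhaseFamily z C) {G : Set A}
    (hG : ∀ g ∈ G, g ∈ C ∨ ∃ i, g = z i) {a : A} (ha : a ∈ StarAlgebra.adjoin ℂ G) :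
    a ∈ Submodule.span ℂ {y | ∃ c ∈ C, ∃ n, y = c * starMonomial z n} := by
  set S := Submodule.span ℂ {y | ∃ c ∈ C, ∃ n, y = c * starMonomial z n} with hS
  have hgen : ∀ g : A, (∀ c ∈ C, ∀ n, g * (c * starMonomial z n) ∈ S) → ∀ s ∈ S, g * s ∈ S := by
    intro g hg s hs
    induction hs using Submodule.span_induction with
    | mem x hx => obtain ⟨c, hc, n, rfl⟩ := hx; exact hg c hc n
    | zero => rw [mul_zero]; exact zero_mem S
    | add x y _ _ hx hy => rw [mul_add]; exact add_mem hx hy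
    | smul c x _ hx => rw [mul_smul_comm]; exact S.smul_mem c hx
  have hC : ∀ c ∈ C, ∀ s ∈ S, c * s ∈ S := fun c hc => hgen c fun c' hc' n =>
    Submodule.subset_span ⟨c * c', mul_mem hc hc', n, (mul_assoc _ _ _).symm⟩
  have hl : ∀ g ∈ G ∪ star G, ∀ s ∈ S, g * s ∈ S := by
    rintro g (hg | hg)
    · rcases hG g hg with hg | ⟨i, rfl⟩
      · exact hC g hg
      · refine hgen _ fun c hc n => ?_
        obtain ⟨c', hc', n', e⟩ := h.exists_mul_starMonomial n i
        rw [← mul_assoc, ← h.commute c hc, mul_assoc, e]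
        exact hC c hc _ (Submodule.subset_span ⟨c', hc', n', rfl⟩)
    · rcases hG _ hg with hg | ⟨i, hi⟩
      · exact hC g (by simpa using star_mem hg)
      · obtain rfl : g = star (z i) := by rw [← hi, star_star]
        refine hgen _ fun c hc n => ?_
        obtain ⟨c', hc', n', e⟩ := h.exists_star_mul_starMonomial n i
        rw [← mul_assoc, ← h.commute_star hc, mul_assoc, e]
        exact hC c hc _ (Submodule.subset_span ⟨c', hc', n', rfl⟩)
  have h1 : (1 : A) ∈ S :=
    Submodule.subset_span ⟨1, one_mem C, 0, by rw [starMonomial_zero, mul_one]⟩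
  -- Since `1 ∈ S`, it is enough that left multiplication by the generated algebra preserves `S`;
  -- products of two monomials never have to be reordered.
  suffices H : ∀ s ∈ S, a * s ∈ S by simpa using H 1 h1
  change a ∈ Algebra.adjoin ℂ (G ∪ star G) at ha
  induction ha using Algebra.adjoin_induction with
  | mem g hg => exact hl g hg
  | algebraMap c =>
    intro s hs
    rw [← Algebra.smul_def]
    exact S.smul_mem c hs
  | add x y _ _ hx hy => intro s hs; rw [add_mul]; exact add_mem (hx s hs) (hy s hs)
  | mul x y _ _ hx hy => intro s hs; rw [mul_assoc]; exact hx _ (hy s hs)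

end IsPhaseFamily

end Monomials

/-! ### Fourier coefficients of vector-valued functions on the torus -/

section Fourier

open MeasureTheory UnitAddTorus

/-- The normalised Haar measure on the torus. -/
noncomputable def torusHaar (m : ℕ) : Measure (UnitAddTorus (Fin m)) :=
  Measure.pi fun _ => AddCircle.haarAddCircle

instance (m : ℕ) : IsProbabilityMeasure (torusHaar m) :=
  inferInstanceAs (IsProbabilityMeasure (Measure.pi fun _ => AddCircle.haarAddCircle))

instance (m : ℕ) : (torusHaar m).IsAddRightInvariant :=
  inferInstanceAs (Measure.IsAddRightInvariant (Measure.pi fun _ => AddCircle.haarAddCircle))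

variable {m : ℕ} {V : Type*} [NormedAddCommGroup V] [NormedSpace ℂ V]

theorem integrable_mFourier_smul (n : Fin m → ℤ) (F : C(UnitAddTorus (Fin m), V)) :
    Integrable (fun s => mFourier n s • F s) (torusHaar m) :=
  Continuous.integrable_of_hasCompactSupport (by fun_prop)
    (HasCompactSupport.of_compactSpace _)

/-- The `n`-th Fourier coefficient, as a continuous linear map. -/
noncomputable def torusCoeff (n : Fin m → ℤ) : C(UnitAddTorus (Fin m), V) →L[ℂ] V :=
  LinearMap.mkContinuous
    { toFun := fun F => ∫ s, mFourier (-n) s • F s ∂torusHaar m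
      map_add' := fun F G => by
        rw [← integral_add (integrable_mFourier_smul _ F) (integrable_mFourier_smul _ G)]
        simp
      map_smul' := fun c F => by
        rw [RingHom.id_apply, ← integral_smul]
        simp [smul_comm c] } 1 fun F => by
    have h : ∀ s, ‖mFourier (-n) s • F s‖ ≤ 1 * ‖F‖ := fun s => by
      rw [norm_smul]
      refine mul_le_mul ?_ (F.norm_coe_le_norm s) (norm_nonneg _) zero_le_one
      exact ((mFourier (-n)).norm_coe_le_norm s).trans mFourier_norm.le
    simpa using norm_integral_le_of_norm_le_const (μ := torusHaar m) (Filter.Eventually.of_forall h)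

theorem torusCoeff_apply (n : Fin m → ℤ) (F : C(UnitAddTorus (Fin m), V)) :
    torusCoeff n F = ∫ s, mFourier (-n) s • F s ∂torusHaar m := rfl

/-- A Fourier coefficient vanishes if its integrand is multiplied by a scalar `c ≠ 1` under some
translation. -/
theorem torusCoeff_eq_zero_of_translate {n : Fin m → ℤ} {F : C(UnitAddTorus (Fin m), V)}
    (r : UnitAddTorus (Fin m)) {c : ℂ} (hc : c ≠ 1)
    (h : ∀ s, mFourier (-n) (s + r) • F (s + r) = c • (mFourier (-n) s • F s)) :
    torusCoeff n F = 0 := by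
  have h1 : torusCoeff n F = c • torusCoeff n F := by
    rw [torusCoeff_apply, ← integral_smul, ← integral_add_right_eq_self _ r]
    exact integral_congr_ae (Filter.Eventually.of_forall h)
  have h2 : (1 - c) • torusCoeff n F = 0 := by rw [sub_smul, one_smul, ← h1, sub_self]
  exact (smul_eq_zero.mp h2).resolve_left (sub_ne_zero.mpr hc.symm)

theorem mFourier_apply_add (n : Fin m → ℤ) (s r : UnitAddTorus (Fin m)) :
    mFourier n (s + r) = mFourier n s * mFourier n r := by
  simp [mFourier, fourier_apply, smul_add, AddCircle.toCircle_add, Finset.prod_mul_distrib]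

theorem exists_mFourier_single_ne_one {n : Fin m → ℤ} {i : Fin m} (hn : n i ≠ 0) :
    ∃ r : UnitAddCircle, mFourier n (Pi.single i r) ≠ 1 := by
  -- The point `1 / (2 n_i)` is half a period of the character, which takes the value `exp(πi) = -1`
  -- there.
  refine ⟨((1 / 2 / n i : ℝ) : UnitAddCircle), ?_⟩
  have h : mFourier n (Pi.single i ((1 / 2 / n i : ℝ) : UnitAddCircle)) = -1 := by
    rw [mFourier, ContinuousMap.coe_mk, Finset.prod_eq_single i]
    · rw [Pi.single_eq_same, fourier_coe_apply]
      have : (n i : ℂ) ≠ 0 := by exact_mod_cast hn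
      rw [← Complex.exp_pi_mul_I]
      congr 1
      push_cast
      field_simp
    · intro j _ hj
      rw [Pi.single_eq_of_ne hj]
      simp
    · simp
  rw [h]
  norm_num

/-- A function constant in the direction `i` has no frequencies with `n i ≠ 0`. This is how
membership in `A_θ(i)` becomes a vanishing condition on components. -/
theorem torusCoeff_eq_zero_of_translate_single {n : Fin m → ℤ} {F : C(UnitAddTorus (Fin m), V)}
    {i : Fin m} (hn : n i ≠ 0) (h : ∀ s r, F (s + Pi.single i r) = F s) :
    torusCoeff n F = 0 := by
  obtain ⟨r, hr⟩ := exists_mFourier_single_ne_one (n := -n) (i := i) (by simpa using hn)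
  refine torusCoeff_eq_zero_of_translate (Pi.single i r) hr fun s => ?_
  rw [h, mFourier_apply_add, mul_comm, mul_smul]

theorem torusCoeff_of_eq_mFourier_smul [CompleteSpace V] {F : C(UnitAddTorus (Fin m), V)}
    {k : Fin m → ℤ} {v : V} (hF : ∀ s, F s = mFourier k s • v) (n : Fin m → ℤ) :
    torusCoeff n F = if n = k then v else 0 := by
  have hF' : ∀ s, mFourier (-n) s • F s = mFourier (-n + k) s • v := fun s => by
    rw [hF, smul_smul, mFourier_add]
  split_ifs with h
  · subst h
    rw [torusCoeff_apply]
    simp [hF', mFourier_zero]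
  · obtain ⟨i, hi⟩ := Function.ne_iff.mp h
    obtain ⟨r, hr⟩ := exists_mFourier_single_ne_one (n := -n + k) (i := i)
      (by simp only [Pi.add_apply, Pi.neg_apply]; omega)
    refine torusCoeff_eq_zero_of_translate (Pi.single i r) hr fun s => ?_
    rw [hF', hF', mFourier_apply_add, mul_comm, mul_smul]

theorem map_torusCoeff {W : Type*} [NormedAddCommGroup W] [NormedSpace ℂ W] [CompleteSpace V]
    [CompleteSpace W] (L : V →L[ℂ] W) (n : Fin m → ℤ) {F : C(UnitAddTorus (Fin m), V)}
    {G : C(UnitAddTorus (Fin m), W)} (h : ∀ s, L (F s) = G s) :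
    L (torusCoeff n F) = torusCoeff n G := by
  rw [torusCoeff_apply, torusCoeff_apply,
    ← ContinuousLinearMap.integral_comp_comm L (integrable_mFourier_smul _ F)]
  simp [h]

/-- The zero family of coefficients is summable, so the Fourier series converges uniformly to `f`;
its sum is `0`. -/
theorem eq_zero_of_torusCoeff_eq_zero {f : C(UnitAddTorus (Fin m), ℂ)}
    (h : ∀ n, torusCoeff n f = 0) : f = 0 := by
  have h0 : mFourierCoeff f = 0 := funext h
  have hs := hasSum_mFourier_series_of_summable (f := f) (by rw [h0]; exact summable_zero)
  have h1 : (fun n => mFourierCoeff f n • mFourier n) =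
      fun _ => (0 : C(UnitAddTorus (Fin m), ℂ)) := by
    rw [h0]
    funext n
    exact zero_smul ℂ (mFourier n)
  rw [h1] at hs
  exact hs.unique hasSum_zero

/-- A closed subspace that contains all Fourier coefficients of a continuous function contains all
of its values. -/
theorem mem_of_torusCoeff_mem [CompleteSpace V] {W : Submodule ℂ V} (hW : IsClosed (W : Set V))
    {F : C(UnitAddTorus (Fin m), V)} (h : ∀ n, torusCoeff n F ∈ W) (s : UnitAddTorus (Fin m)) :
    F s ∈ W := by
  have : IsClosed (W : Set V) := hW
  rw [← Submodule.Quotient.mk_eq_zero]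
  by_contra hne
  -- By Hahn–Banach on `V ⧸ W`, a value outside `W` is detected by a functional that kills `W`.
  -- Composing with it leaves a scalar function all of whose coefficients vanish.
  obtain ⟨g, -, hg⟩ := exists_dual_vector ℂ (Submodule.Quotient.mk (p := W) (F s))
    (norm_ne_zero_iff.mpr hne)
  have hmk : Continuous (W.mkQ : V → V ⧸ W) := W.isQuotientMap_mkQ.continuous
  let L : V →L[ℂ] ℂ := g.comp ⟨W.mkQ, hmk⟩
  have hL : ∀ v, L v = g (Submodule.Quotient.mk v) := fun v => rfl
  have h0 : (⟨fun s => L (F s), by fun_prop⟩ : C(UnitAddTorus (Fin m), ℂ)) = 0 :=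
    eq_zero_of_torusCoeff_eq_zero fun n => by
      rw [← map_torusCoeff L n (F := F) fun _ => rfl, hL, (Submodule.Quotient.mk_eq_zero W).mpr (h n),
        map_zero]
  have h1 := DFunLike.congr_fun h0 s
  rw [ContinuousMap.coe_mk, hL, hg, ContinuousMap.zero_apply] at h1
  exact hne (norm_eq_zero.mp (RCLike.ofReal_eq_zero.mp h1))

end Fourier

/-! ### Gauge actions of the torus -/

section MapMonomial

theorem starZPow_smul {A : Type*} [Ring A] [StarRing A] [Algebra ℂ A] [StarModule ℂ A] (c : ℂ)
    (a : A) (k : ℤ) : starZPow (c • a) k = starZPow c k • starZPow a k := by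
  obtain ⟨k, rfl | rfl⟩ := k.eq_nat_or_neg
  · simp only [starZPow_natCast, smul_pow]
  · simp only [starZPow_neg_natCast, star_smul, smul_pow]

theorem map_starZPow {A B : Type*} [Ring A] [StarRing A] [Algebra ℂ A] [Ring B] [StarRing B]
    [Algebra ℂ B] (f : A →⋆ₐ[ℂ] B) (a : A) (k : ℤ) : f (starZPow a k) = starZPow (f a) k := by
  obtain ⟨k, rfl | rfl⟩ := k.eq_nat_or_neg
  · simp only [starZPow_natCast, map_pow]
  · simp only [starZPow_neg_natCast, map_pow, map_star]

/-- A `*`-homomorphism that rescales the members of a family rescales their monomials. -/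
theorem map_starMonomial {A B : Type*} [Ring A] [StarRing A] [Algebra ℂ A] [Ring B] [StarRing B]
    [Algebra ℂ B] [StarModule ℂ B] {m : ℕ} (f : A →⋆ₐ[ℂ] B) {z : Fin m → A} {w : Fin m → B}
    {c : Fin m → ℂ} (h : ∀ i, f (z i) = c i • w i) (n : Fin m → ℤ) :
    f (starMonomial z n) = (∏ i, starZPow (c i) (n i)) • starMonomial w n := by
  rw [starMonomial, starMonomial, Fin.prod_univ_def]
  induction List.finRange m with
  | nil => simp
  | cons j t ih =>
    simp only [List.map_cons, List.prod_cons, map_mul, ih, map_starZPow, h, starZPow_smul,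
      smul_mul_smul_comm]

theorem starZPow_fourier (k : ℤ) (s : UnitAddCircle) : starZPow (fourier 1 s : ℂ) k = fourier k s := by
  obtain ⟨k, rfl | rfl⟩ := k.eq_nat_or_neg
  · simp [fourier_apply, AddCircle.toCircle_nsmul]
  · rw [starZPow_neg_natCast, fourier_neg]
    simp [fourier_apply, AddCircle.toCircle_nsmul]

/-- A real number is its own adjoint, so both signs of `k` give the power `|k|`; hence the exponents
in `octantMonomial`. -/
theorem starZPow_ofReal (r : ℝ) (k : ℤ) : starZPow (r : ℂ) k = (r : ℂ) ^ k.natAbs := by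
  obtain ⟨k, rfl | rfl⟩ := k.eq_nat_or_neg
  · simp
  · rw [starZPow_neg_natCast]
    simp

end MapMonomial

/-! ### Gauge actions and weight components -/

section Gauge

open UnitAddTorus
open scoped CStarAlgebra

variable {m : ℕ} {A : Type*} [CStarAlgebra A]

/-- Evaluation at a point, as a `*`-homomorphism. -/
noncomputable def evalHom {X : Type*} [TopologicalSpace X] (A : Type*) [CStarAlgebra A] (s : X) :
    C(X, A) →⋆ₐ[ℂ] A where
  toFun F := F s
  map_one' := rfl
  map_mul' _ _ := rfl
  map_zero' := rfl
  map_add' _ _ := rfl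
  commutes' _ := rfl
  map_star' _ := rfl

/-- A gauge action of the torus for a phase family `z`: the generator `z i` has weight `i`, the
elements of `C` are fixed, and the products of elements of `C` and monomials are total. -/
structure IsGaugeAction (z : Fin m → A) (C : StarSubalgebra ℂ A)
    (Ψ : A →⋆ₐ[ℂ] C(UnitAddTorus (Fin m), A)) : Prop extends IsPhaseFamily z C where
  gen : ∀ i s, Ψ (z i) s = (fourier 1 (s i) : ℂ) • z i
  fixed : ∀ c ∈ C, ∀ s, Ψ c s = c
  dense : ∀ a, a ∈ closure (Submodule.span ℂ {y | ∃ c ∈ C, ∃ n, y = c * starMonomial z n} : Set A)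

namespace IsGaugeAction

variable {z : Fin m → A} {C : StarSubalgebra ℂ A} {Ψ : A →⋆ₐ[ℂ] C(UnitAddTorus (Fin m), A)}

theorem apply_mul_starMonomial (h : IsGaugeAction z C Ψ) {c : A} (hc : c ∈ C) (n : Fin m → ℤ)
    (s : UnitAddTorus (Fin m)) :
    Ψ (c * starMonomial z n) s = mFourier n s • (c * starMonomial z n) := by
  have h1 := map_starMonomial ((evalHom A s).comp Ψ) (z := z) (w := z)
    (c := fun i => fourier 1 (s i)) (fun i => h.gen i s) n
  simp only [starZPow_fourier] at h1
  rw [map_mul, ContinuousMap.mul_apply, h.fixed c hc, ← mul_smul_comm]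
  exact congrArg (c * ·) h1

/-- The elements `c * starMonomial z n` with `c ∈ C`. -/
noncomputable def weightSpace (z : Fin m → A) (C : StarSubalgebra ℂ A) (n : Fin m → ℤ) : Submodule ℂ A :=
  (Subalgebra.toSubmodule C.toSubalgebra).map (LinearMap.mulRight ℂ (starMonomial z n))

theorem mem_weightSpace {n : Fin m → ℤ} {y : A} :
    y ∈ weightSpace z C n ↔ ∃ c ∈ C, c * starMonomial z n = y := Iff.rfl

/-- The component of weight `n` lies in the closure of the elements `c * starMonomial z n`. -/
theorem torusCoeff_mem_closure (h : IsGaugeAction z C Ψ) (n : Fin m → ℤ) (a : A) :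
    torusCoeff n (Ψ a) ∈ closure (weightSpace z C n : Set A) := by
  have hcont : Continuous fun a => torusCoeff n (Ψ a) :=
    (torusCoeff n).continuous.comp (map_continuous Ψ)
  -- By continuity only the total set matters, where the coefficient keeps the terms of weight `n`
  -- and kills the others.
  refine map_mem_closure (f := fun a => torusCoeff n (Ψ a)) hcont (h.dense a) fun y hy => ?_
  change torusCoeff n (Ψ y) ∈ weightSpace z C n
  induction hy using Submodule.span_induction with
  | mem y hy =>
    obtain ⟨c, hc, k, rfl⟩ := hy
    rw [torusCoeff_of_eq_mFourier_smul (h.apply_mul_starMonomial hc k)]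
    split_ifs with e
    · subst e
      exact mem_weightSpace.mpr ⟨c, hc, rfl⟩
    · exact zero_mem _
  | zero => simp only [map_zero]; exact zero_mem _
  | add x y _ _ hx hy => simp only [map_add]; exact add_mem hx hy
  | smul c x _ hx => simp only [map_smul]; exact Submodule.smul_mem _ c hx

/-- For `y = c M` with `M` a monomial, `y^* y = (M^* M)(c^* c)`, because `C` commutes with `M`. The
norm of a component can thus be tested inside the closure of `C`. -/
theorem star_mul_self_mem_closure (h : IsGaugeAction z C Ψ) (n : Fin m → ℤ) {y : A}
    (hy : y ∈ closure (weightSpace z C n : Set A)) : star y * y ∈ closure (C : Set A) := by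
  refine map_mem_closure (f := fun y => star y * y) (by fun_prop) hy ?_
  rintro _ ⟨c, hc, rfl⟩
  change star (c * starMonomial z n) * (c * starMonomial z n) ∈ C
  have hcc : star c * c ∈ C := mul_mem (star_mem hc) hc
  rw [star_mul, mul_assoc, ← mul_assoc (star c), (h.commute_starMonomial hcc n).eq, ← mul_assoc]
  exact mul_mem (h.star_mul_self_starMonomial_mem n) hcc

end IsGaugeAction

/-- Normal elements that commute up to phases form a phase family. -/
theorem isPhaseFamily_of_normal {z : Fin m → A} {C : StarSubalgebra ℂ A} {c : Fin m → Fin m → ℂ}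
    (hc : ∀ i j, c i j ≠ 0) (hn : ∀ i, star (z i) * z i = z i * star (z i))
    (hz : ∀ i j, z i * z j = c i j • (z j * z i)) (hm : ∀ i, z i * star (z i) ∈ C)
    (hC : ∀ x ∈ C, ∀ i, x * z i = z i * x) : IsPhaseFamily z C where
  normal := hn
  mul_star_mem := hm
  commute := hC
  phase i j := ⟨c i j, hc i j, hz i j⟩
  phase_star i j := by
    have h1 : IsStarNormal (z j) := ⟨hn j⟩
    have h2 : IsStarNormal (c i j • z j) := ⟨by
      rw [star_smul]; exact (h1.star_comm_self.smul_left _).smul_right _⟩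
    have h3 : SemiconjBy (z i) (z j) (c i j • z j) := by
      rw [SemiconjBy, hz, smul_mul_assoc]
    -- An element intertwining two normal elements also intertwines their adjoints, so the phase
    -- relations with adjoints follow from those without.
    have h4 := fuglede_putnam_rosenblum h1 h2 h3
    refine ⟨star (c i j), star_ne_zero.mpr (hc i j), ?_⟩
    rw [h4.eq, star_smul, smul_mul_assoc]

end Gauge

/-! ### The homomorphism from the even sphere to the field of noncommutative tori -/

section Families

open FreeStarAlgebra

variable {m : ℕ} {θ : Matrix (Fin m) (Fin m) ℝ} {B : Type*} [CStarAlgebra B]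

/-- The relations of the even sphere, in a C*-algebra. -/
structure IsSphereFamily (θ : Matrix (Fin m) (Fin m) ℝ) (z : Fin m → B) (x : B) : Prop where
  normal : ∀ i, star (z i) * z i = z i * star (z i)
  selfAdjoint : star x = x
  sum_eq : ∑ i, z i * star (z i) + x ^ 2 = 1
  comm : ∀ i j, z i * z j = rho θ j i • (z j * z i)
  comm_x : ∀ i, x * z i = z i * x

theorem IsSphereFamily.lift_eq_zero {z : Fin m → B} {x : B} (h : IsSphereFamily θ z x) :
    ∀ r ∈ evenSphereRelations θ, FreeStarAlgebra.lift (fun o => Option.elim o x z) r = 0 := by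
  rintro r (⟨i, rfl⟩ | rfl | rfl | ⟨i, j, rfl⟩ | ⟨i, rfl⟩)
  · simp [freeZ, h.normal, map_star]
  · simp [freeX, h.selfAdjoint, map_star]
  · simp [freeX, freeZ, h.sum_eq, map_star]
  · simp [freeZ, h.comm i j]
  · simp [freeX, freeZ, h.comm_x]

theorem isSphereFamily_zx (θ : Matrix (Fin m) (Fin m) ℝ) :
    IsSphereFamily θ (EvenSphere.z θ) (EvenSphere.x θ) where
  normal i := by
    have := UniversalCStar.of_eq_zero (evenSphereRelations θ) (Or.inl ⟨i, rfl⟩)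
    rwa [freeZ, map_sub, map_mul, map_mul, ← UniversalCStar.star_gen, sub_eq_zero] at this
  selfAdjoint := by
    have := UniversalCStar.of_eq_zero (evenSphereRelations θ) (Or.inr (Or.inl rfl))
    rw [freeX, map_sub, ← UniversalCStar.star_gen] at this
    exact sub_eq_zero.mp this
  sum_eq := by
    have := UniversalCStar.of_eq_zero (evenSphereRelations θ) (Or.inr (Or.inr (Or.inl rfl)))
    simp only [freeX, freeZ, map_sub, map_add, map_sum, map_mul, map_pow, map_one,
      ← UniversalCStar.star_gen, sub_eq_zero] at this
    exact this
  comm i j := by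
    have := UniversalCStar.of_eq_zero (evenSphereRelations θ)
      (Or.inr (Or.inr (Or.inr (Or.inl ⟨i, j, rfl⟩))))
    rwa [freeZ, freeZ, map_sub, map_smul, map_mul, map_mul, sub_eq_zero] at this
  comm_x i := by
    have := UniversalCStar.of_eq_zero (evenSphereRelations θ)
      (Or.inr (Or.inr (Or.inr (Or.inr ⟨i, rfl⟩))))
    rwa [freeX, freeZ, map_sub, map_mul, map_mul, sub_eq_zero] at this

theorem isTorusFamily_of_forall {X : Type*} [TopologicalSpace X] [CompactSpace X]
    {u : Fin m → C(X, B)} (h : ∀ s, IsTorusFamily θ fun i => u i s) : IsTorusFamily θ u where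
  star_mul i := ContinuousMap.ext fun s => (h s).star_mul i
  mul_star i := ContinuousMap.ext fun s => (h s).mul_star i
  comm i j := ContinuousMap.ext fun s => (h s).comm i j

theorem isSphereFamily_of_forall {X : Type*} [TopologicalSpace X] [CompactSpace X]
    {z : Fin m → C(X, B)} {x : C(X, B)} (h : ∀ s, IsSphereFamily θ (fun i => z i s) (x s)) :
    IsSphereFamily θ z x where
  normal i := ContinuousMap.ext fun s => (h s).normal i
  selfAdjoint := ContinuousMap.ext fun s => (h s).selfAdjoint
  sum_eq := ContinuousMap.ext fun s => by simpa using (h s).sum_eq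
  comm i j := ContinuousMap.ext fun s => (h s).comm i j
  comm_x i := ContinuousMap.ext fun s => (h s).comm_x i

theorem IsTorusFamily.smul {u : Fin m → B} (h : IsTorusFamily θ u) {c : Fin m → ℂ}
    (hc : ∀ i, star (c i) * c i = 1) : IsTorusFamily θ fun i => c i • u i where
  star_mul i := by rw [star_smul, smul_mul_smul_comm, hc, h.star_mul, one_smul]
  mul_star i := by rw [star_smul, smul_mul_smul_comm, mul_comm (c i), hc, h.mul_star, one_smul]
  comm i j := by
    rw [smul_mul_smul_comm, smul_mul_smul_comm, h.comm, smul_comm, mul_comm (c i)]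

theorem IsSphereFamily.smul {z : Fin m → B} {x : B} (h : IsSphereFamily θ z x) {c : Fin m → ℂ}
    (hc : ∀ i, star (c i) * c i = 1) : IsSphereFamily θ (fun i => c i • z i) x where
  normal i := by rw [star_smul, smul_mul_smul_comm, smul_mul_smul_comm, h.normal, mul_comm (c i)]
  selfAdjoint := h.selfAdjoint
  sum_eq := by
    simp only [star_smul, smul_mul_smul_comm, mul_comm (c _), hc, one_smul]
    exact h.sum_eq
  comm i j := by
    rw [smul_mul_smul_comm, smul_mul_smul_comm, h.comm, smul_comm, mul_comm (c i)]
  comm_x i := by rw [smul_mul_assoc, mul_smul_comm, h.comm_x]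

theorem IsTorusFamily.isSphereFamily {u : Fin m → B} (h : IsTorusFamily θ u) {r : Fin m → ℝ}
    {r' : ℝ} (hr : ∑ i, r i ^ 2 + r' ^ 2 = 1) :
    IsSphereFamily θ (fun i => (r i : ℂ) • u i) ((r' : ℂ) • (1 : B)) where
  normal i := by
    rw [star_smul, smul_mul_smul_comm, smul_mul_smul_comm, h.star_mul, h.mul_star, mul_comm]
  selfAdjoint := by simp
  sum_eq := by
    have h1 : ∀ i, ((r i : ℂ) • u i) * star ((r i : ℂ) • u i) = ((r i : ℂ) ^ 2) • (1 : B) := by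
      intro i
      rw [star_smul, smul_mul_smul_comm, h.mul_star]
      simp [sq]
    simp only [h1]
    rw [← Finset.sum_smul, smul_pow, one_pow, ← add_smul]
    have h2 : (∑ i, (r i : ℂ) ^ 2 + (r' : ℂ) ^ 2) = 1 := by exact_mod_cast hr
    rw [h2, one_smul]
  comm i j := by
    rw [smul_mul_smul_comm, smul_mul_smul_comm, h.comm, smul_comm, mul_comm (r i : ℂ)]
  comm_x i := by rw [smul_mul_assoc, one_mul, mul_smul_comm, mul_one]

/-- The `*`-subalgebra generated by the central elements `z i * star (z i)` and `x`. -/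
def sphereCentre (z : Fin m → B) (x : B) : StarSubalgebra ℂ B :=
  StarAlgebra.adjoin ℂ (insert x (Set.range fun i => z i * star (z i)))

theorem isPhaseFamily_U (θ : Matrix (Fin m) (Fin m) ℝ) :
    IsPhaseFamily (NCTorus.U θ) (⊥ : StarSubalgebra ℂ (NCTorus θ)) := by
  have h := isTorusFamily_U θ
  refine isPhaseFamily_of_normal (fun i j => rho_ne_zero θ j i)
    (fun i => by rw [h.star_mul, h.mul_star]) h.comm (fun i => by rw [h.mul_star]; exact one_mem _) ?_
  rintro _ ⟨c, rfl⟩ i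
  exact Algebra.commutes c _

theorem IsSphereFamily.isPhaseFamily {z : Fin m → B} {x : B} (h : IsSphereFamily θ z x) :
    IsPhaseFamily z (sphereCentre z x) := by
  have hx : ∀ i, z i * x = x * z i := fun i => (h.comm_x i).symm
  have hxs : ∀ i, star (z i) * x = x * star (z i) := fun i => by
    simpa [h.selfAdjoint] using congrArg star (h.comm_x i)
  have hz : ∀ i j, z j * (z i * star (z i)) = z i * star (z i) * z j := fun i j => by
    have h1 : IsStarNormal (z i) := ⟨h.normal i⟩
    have h2 : IsStarNormal (rho θ i j • z i) := ⟨by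
      rw [star_smul]; exact (h1.star_comm_self.smul_left _).smul_right _⟩
    have h3 : SemiconjBy (z j) (z i) (rho θ i j • z i) := by
      rw [SemiconjBy, h.comm, smul_mul_assoc]
    have h4 := fuglede_putnam_rosenblum h1 h2 h3
    have h5 : rho θ i j * star (rho θ i j) = 1 := by
      rw [Complex.star_def, Complex.mul_conj, Complex.normSq_eq_norm_sq, norm_rho]
      simp
    -- Moving `z j` past `z i` and past `star (z i)` produces conjugate unimodular phases, which
    -- cancel; so `z i * star (z i)` is central.
    have h6 := h3.mul_right h4
    rw [star_smul, smul_mul_smul_comm, h5, one_smul] at h6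
    exact h6
  have hzs : ∀ i j, star (z j) * (z i * star (z i)) = z i * star (z i) * star (z j) := fun i j => by
    simpa using (congrArg star (hz i j)).symm
  refine isPhaseFamily_of_normal (c := fun i j => rho θ j i) (fun i j => rho_ne_zero θ j i) h.normal
    h.comm (fun i => StarAlgebra.subset_adjoin ℂ _ (Or.inr ⟨i, rfl⟩)) ?_
  have hle : sphereCentre z x ≤ StarSubalgebra.centralizer ℂ (Set.range z) := by
    refine StarAlgebra.adjoin_le ?_
    rintro _ (rfl | ⟨i, rfl⟩) <;> rw [SetLike.mem_coe, StarSubalgebra.mem_centralizer_iff] <;>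
      rintro _ ⟨j, rfl⟩
    · exact ⟨hx j, hxs j⟩
    · exact ⟨hz i j, hzs i j⟩
  intro c hc i
  exact (((StarSubalgebra.mem_centralizer_iff ℂ).mp (hle hc)) _ ⟨i, rfl⟩).1.symm

end Families

/-! ### The gauge actions on torus and sphere, and the equivariant map between sphere and field -/

section GaugeHoms

open UnitAddTorus

variable {m : ℕ} (θ : Matrix (Fin m) (Fin m) ℝ)

/-- The function `s ↦ f s • a`. -/
noncomputable def scaledConst {X B : Type*} [TopologicalSpace X] [CStarAlgebra B] (f : C(X, ℂ)) (a : B) :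
    C(X, B) := ⟨fun s => f s • a, by fun_prop⟩

/-- The `i`-th coordinate of the torus, as a unimodular function. -/
noncomputable def torusCoord (i : Fin m) : C(UnitAddTorus (Fin m), ℂ) :=
  ⟨fun s => fourier 1 (s i), by fun_prop⟩

theorem star_fourier_mul (s : UnitAddCircle) : star (fourier 1 s : ℂ) * fourier 1 s = 1 := by
  rw [Complex.star_def, ← fourier_neg, ← fourier_add]
  simp

theorem isTorusFamily_scaledConst :
    IsTorusFamily θ fun i => scaledConst (torusCoord i) (NCTorus.U θ i) :=
  isTorusFamily_of_forall fun s => (isTorusFamily_U θ).smul fun i => star_fourier_mul (s i)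

theorem isSphereFamily_scaledConst :
    IsSphereFamily θ (fun i => scaledConst (torusCoord i) (EvenSphere.z θ i))
      (ContinuousMap.const _ (EvenSphere.x θ)) :=
  isSphereFamily_of_forall fun s => (isSphereFamily_zx θ).smul fun i => star_fourier_mul (s i)

/-- The gauge action on the noncommutative torus. -/
noncomputable def torusGauge : NCTorus θ →⋆ₐ[ℂ] C(UnitAddTorus (Fin m), NCTorus θ) :=
  UniversalCStar.lift _ _ (isTorusFamily_scaledConst θ).lift_eq_zero

/-- The gauge action on the even sphere. -/
noncomputable def sphereGauge : EvenSphere θ →⋆ₐ[ℂ] C(UnitAddTorus (Fin m), EvenSphere θ) :=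
  UniversalCStar.lift _ _ (isSphereFamily_scaledConst θ).lift_eq_zero

theorem torusGauge_U (i : Fin m) (s : UnitAddTorus (Fin m)) :
    torusGauge θ (NCTorus.U θ i) s = (fourier 1 (s i) : ℂ) • NCTorus.U θ i :=
  DFunLike.congr_fun
    (UniversalCStar.lift_gen _ _ (isTorusFamily_scaledConst θ).lift_eq_zero i) s

theorem sphereGauge_z (i : Fin m) (s : UnitAddTorus (Fin m)) :
    sphereGauge θ (EvenSphere.z θ i) s = (fourier 1 (s i) : ℂ) • EvenSphere.z θ i :=
  DFunLike.congr_fun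
    (UniversalCStar.lift_gen _ _ (isSphereFamily_scaledConst θ).lift_eq_zero (some i)) s

theorem sphereGauge_x (s : UnitAddTorus (Fin m)) :
    sphereGauge θ (EvenSphere.x θ) s = EvenSphere.x θ :=
  DFunLike.congr_fun
    (UniversalCStar.lift_gen _ _ (isSphereFamily_scaledConst θ).lift_eq_zero none) s

theorem mem_closure_adjoin_gen {ι : Type} (R : Set (FreeStarAlgebra ι)) [BoundedRelations R]
    (a : UniversalCStar R) :
    a ∈ closure (StarAlgebra.adjoin ℂ (Set.range (UniversalCStar.gen R)) : Set _) := by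
  rw [← StarSubalgebra.topologicalClosure_coe, UniversalCStar.adjoin_gen_closure]
  exact Set.mem_univ a

theorem isGaugeAction_torusGauge : IsGaugeAction (NCTorus.U θ) ⊥ (torusGauge θ) where
  __ := isPhaseFamily_U θ
  gen := torusGauge_U θ
  fixed := by
    rintro _ ⟨c, rfl⟩ s
    exact DFunLike.congr_fun (AlgHomClass.commutes (torusGauge θ) c) s
  dense a := closure_mono (fun _ hb => (isPhaseFamily_U θ).adjoin_le_span
    (by rintro _ ⟨i, rfl⟩; exact Or.inr ⟨i, rfl⟩) hb) (mem_closure_adjoin_gen _ a)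

theorem isGaugeAction_sphereGauge : IsGaugeAction (EvenSphere.z θ)
    (sphereCentre (EvenSphere.z θ) (EvenSphere.x θ)) (sphereGauge θ) where
  __ := (isSphereFamily_zx θ).isPhaseFamily
  gen := sphereGauge_z θ
  fixed c hc s := by
    have hle : sphereCentre (EvenSphere.z θ) (EvenSphere.x θ) ≤
        StarAlgHom.equalizer ((evalHom _ s).comp (sphereGauge θ)) (StarAlgHom.id ℂ _) := by
      refine StarAlgebra.adjoin_le ?_
      rintro _ (rfl | ⟨i, rfl⟩)
      · exact sphereGauge_x θ s
      · change sphereGauge θ (EvenSphere.z θ i * star (EvenSphere.z θ i)) s = _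
        rw [map_mul, map_star, ContinuousMap.mul_apply, ContinuousMap.star_apply, sphereGauge_z,
          star_smul, smul_mul_smul_comm, mul_comm (fourier 1 (s i) : ℂ), star_fourier_mul, one_smul]
        rfl
    exact hle hc
  dense a := by
    refine closure_mono (fun _ hb => (isSphereFamily_zx θ).isPhaseFamily.adjoin_le_span ?_ hb)
      (mem_closure_adjoin_gen _ a)
    rintro _ ⟨_ | i, rfl⟩
    · exact Or.inl (StarAlgebra.subset_adjoin ℂ _ (Or.inl rfl))
    · exact Or.inr ⟨i, rfl⟩

theorem sum_sq_partialOctant (t : partialOctant m) :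
    ∑ i : Fin m, t.1 i.castSucc ^ 2 + t.1 (Fin.last m) ^ 2 = 1 := by
  have h := t.2.1
  rw [EuclideanSpace.norm_eq, Real.sqrt_eq_one, Fin.sum_univ_castSucc] at h
  simpa using h

/-- The `i`-th coordinate function on the partial octant. -/
noncomputable def octantCoord (m : ℕ) (i : Fin (m + 1)) : C(partialOctant m, ℂ) :=
  ⟨fun t => (t.1 i : ℝ), by fun_prop⟩

theorem octantCoord_apply (i : Fin (m + 1)) (t : partialOctant m) :
    octantCoord m i t = (t.1 i : ℝ) := rfl

theorem isSphereFamily_octant :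
    IsSphereFamily θ (fun i : Fin m => scaledConst (octantCoord m i.castSucc) (NCTorus.U θ i))
      (scaledConst (octantCoord m (Fin.last m)) 1) :=
  isSphereFamily_of_forall fun t => (isTorusFamily_U θ).isSphereFamily (sum_sq_partialOctant t)

/-- The homomorphism from the even sphere to the continuous functions on the partial octant with
values in the noncommutative torus. -/
noncomputable def sphereToField : EvenSphere θ →⋆ₐ[ℂ] C(partialOctant m, NCTorus θ) :=
  UniversalCStar.lift _ _ (isSphereFamily_octant θ).lift_eq_zero

theorem sphereToField_z (i : Fin m) : sphereToField θ (EvenSphere.z θ i) =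
    scaledConst (octantCoord m i.castSucc) (NCTorus.U θ i) :=
  UniversalCStar.lift_gen _ _ (isSphereFamily_octant θ).lift_eq_zero (some i)

theorem sphereToField_x : sphereToField θ (EvenSphere.x θ) =
    scaledConst (octantCoord m (Fin.last m)) 1 :=
  UniversalCStar.lift_gen _ _ (isSphereFamily_octant θ).lift_eq_zero none

/-- The homomorphism to the field intertwines the gauge actions. -/
theorem sphereToField_sphereGauge (a : EvenSphere θ) (s : UnitAddTorus (Fin m))
    (t : partialOctant m) :
    sphereToField θ (sphereGauge θ a s) t = torusGauge θ (sphereToField θ a t) s := by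
  refine UniversalCStar.hom_ext (evenSphereRelations θ)
    (f := ((evalHom _ t).comp (sphereToField θ)).comp ((evalHom _ s).comp (sphereGauge θ)))
    (g := ((evalHom _ s).comp (torusGauge θ)).comp ((evalHom _ t).comp (sphereToField θ))) ?_ a
  rintro (_ | i)
  · change sphereToField θ (sphereGauge θ (EvenSphere.x θ) s) t =
      torusGauge θ (sphereToField θ (EvenSphere.x θ) t) s
    rw [sphereGauge_x, sphereToField_x]
    simp [scaledConst]
  · change sphereToField θ (sphereGauge θ (EvenSphere.z θ i) s) t =
      torusGauge θ (sphereToField θ (EvenSphere.z θ i) t) s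
    rw [sphereGauge_z, map_smul, sphereToField_z]
    change (fourier 1 (s i) : ℂ) • octantCoord m i.castSucc t • NCTorus.U θ i =
      torusGauge θ (octantCoord m i.castSucc t • NCTorus.U θ i) s
    rw [map_smul, ContinuousMap.smul_apply, torusGauge_U, smul_comm]

end GaugeHoms

/-! ### Injectivity -/

section Injectivity

open UnitAddTorus WeakDual
open scoped CStarAlgebra

variable {m : ℕ} (θ : Matrix (Fin m) (Fin m) ℝ)

/-- The generators are self-adjoint and commute pairwise, so they commute with each other's adjoints
too. Commutativity opens the closure of this algebra to Gelfand theory. -/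
theorem sphereCentre_comm (a b : sphereCentre (EvenSphere.z θ) (EvenSphere.x θ)) :
    a * b = b * a := by
  have h := isSphereFamily_zx θ
  have hp := h.isPhaseFamily
  have hmem : ∀ a ∈ insert (EvenSphere.x θ)
      (Set.range fun i => EvenSphere.z θ i * star (EvenSphere.z θ i)),
      a ∈ sphereCentre (EvenSphere.z θ) (EvenSphere.x θ) := fun a ha =>
    StarAlgebra.subset_adjoin ℂ _ ha
  have hcomm : ∀ a ∈ insert (EvenSphere.x θ)
      (Set.range fun i => EvenSphere.z θ i * star (EvenSphere.z θ i)),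
      ∀ b ∈ insert (EvenSphere.x θ)
      (Set.range fun i => EvenSphere.z θ i * star (EvenSphere.z θ i)), a * b = b * a := by
    have key : ∀ a ∈ sphereCentre (EvenSphere.z θ) (EvenSphere.x θ), ∀ j,
        a * (EvenSphere.z θ j * star (EvenSphere.z θ j)) =
          EvenSphere.z θ j * star (EvenSphere.z θ j) * a := fun a ha j => by
      rw [← mul_assoc, hp.commute a ha, mul_assoc, hp.commute_star ha, mul_assoc]
    intro a ha b hb
    rcases hb with rfl | ⟨j, rfl⟩
    · rcases ha with rfl | ⟨i, rfl⟩
      · rfl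
      · exact (key _ (hmem _ (Or.inl rfl)) i).symm
    · exact key a (hmem a ha) j
  have hstar : ∀ b ∈ insert (EvenSphere.x θ)
      (Set.range fun i => EvenSphere.z θ i * star (EvenSphere.z θ i)), star b = b := by
    rintro _ (rfl | ⟨i, rfl⟩)
    · exact h.selfAdjoint
    · simp
  have := StarAlgebra.isMulCommutative_adjoin ℂ hcomm fun a ha b hb => by
    rw [hstar b hb]; exact hcomm a ha b hb
  exact this.is_comm.comm a b

/-- The norm-closed central subalgebra generated by `x` and the elements `z i * star (z i)`. -/
noncomputable def closedSphereCentre : StarSubalgebra ℂ (EvenSphere θ) :=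
  (sphereCentre (EvenSphere.z θ) (EvenSphere.x θ)).topologicalClosure

instance : IsClosed (closedSphereCentre θ : Set (EvenSphere θ)) :=
  StarSubalgebra.isClosed_topologicalClosure _

noncomputable instance : CommCStarAlgebra (closedSphereCentre θ) where
  mul_comm := (StarSubalgebra.commRingTopologicalClosure _ (sphereCentre_comm θ)).mul_comm

/-- The element `z i * star (z i)` of the closed central subalgebra. -/
noncomputable def centralSq (i : Fin m) : closedSphereCentre θ :=
  ⟨EvenSphere.z θ i * star (EvenSphere.z θ i), StarSubalgebra.le_topologicalClosure _
    (StarAlgebra.subset_adjoin ℂ _ (Or.inr ⟨i, rfl⟩))⟩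

/-- The element `x` of the closed central subalgebra. -/
noncomputable def centralX : closedSphereCentre θ :=
  ⟨EvenSphere.x θ, StarSubalgebra.le_topologicalClosure _
    (StarAlgebra.subset_adjoin ℂ _ (Or.inl rfl))⟩

/-- The value of a character lies in the spectrum, and `z i * star (z i)` is positive. The number
`r` is the square root of that value, so that it can serve as a coordinate of a point of the octant.
-/
theorem exists_character_centralSq (χ : characterSpace ℂ (closedSphereCentre θ)) (i : Fin m) :
    ∃ r : ℝ, 0 ≤ r ∧ χ (centralSq θ i) = ((r ^ 2 : ℝ) : ℂ) := by
  have hsa : star (χ (centralSq θ i)) = χ (centralSq θ i) := by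
    rw [← map_star]
    congr 1
    exact Subtype.ext (by simp [centralSq])
  obtain ⟨r, hr⟩ := Complex.conj_eq_iff_real.mp hsa
  have h1 : χ (centralSq θ i) ∈ spectrum ℂ (centralSq θ i) :=
    CharacterSpace.apply_mem_spectrum χ _
  -- Spectral permanence: the spectrum may be computed in the whole sphere algebra, where `z i`
  -- itself is available.
  rw [StarSubalgebra.spectrum_eq, hr] at h1
  have h2 : r ∈ spectrum ℝ (star (star (EvenSphere.z θ i)) * star (EvenSphere.z θ i)) := by
    rw [star_star]
    exact (spectrum.algebraMap_mem_iff ℂ (R := ℝ)).mp h1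
  have h3 : 0 ≤ r := spectrum_star_mul_self_nonneg r h2
  exact ⟨√r, Real.sqrt_nonneg r, by rw [Real.sq_sqrt h3, hr]⟩

theorem exists_character_centralX (χ : characterSpace ℂ (closedSphereCentre θ)) :
    ∃ r : ℝ, χ (centralX θ) = r := by
  have hsa : star (χ (centralX θ)) = χ (centralX θ) := by
    rw [← map_star]
    congr 1
    exact Subtype.ext (isSphereFamily_zx θ).selfAdjoint
  exact Complex.conj_eq_iff_real.mp hsa

/-- Every character of the closed central subalgebra is the evaluation at a point of the partial
octant. -/
theorem exists_point_of_character (χ : characterSpace ℂ (closedSphereCentre θ)) :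
    ∃ t : partialOctant m, (∀ i : Fin m, χ (centralSq θ i) = ((t.1 i.castSucc ^ 2 : ℝ) : ℂ)) ∧
      χ (centralX θ) = (t.1 (Fin.last m) : ℝ) := by
  choose r hr0 hr using exists_character_centralSq θ χ
  obtain ⟨r', hr'⟩ := exists_character_centralX θ χ
  have hsum : ∑ i, r i ^ 2 + r' ^ 2 = 1 := by
    have h1 : ∑ i, centralSq θ i + centralX θ ^ 2 = 1 :=
      Subtype.ext (by simpa [centralSq, centralX] using (isSphereFamily_zx θ).sum_eq)
    have h2 := congrArg χ h1
    rw [map_add, map_sum, map_pow, map_one, hr'] at h2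
    simp only [hr] at h2
    exact_mod_cast h2
  refine ⟨⟨WithLp.toLp 2 (Fin.snoc r r'), ?_, fun k => ?_⟩, fun i => ?_, ?_⟩
  · rw [EuclideanSpace.norm_eq, Real.sqrt_eq_one, Fin.sum_univ_castSucc]
    simpa using hsum
  · simpa using hr0 k
  · simpa using hr i
  · simpa using hr'

/-- A character, as a homomorphism with values in the scalars of the noncommutative torus. -/
noncomputable def characterHom (χ : characterSpace ℂ (closedSphereCentre θ)) :
    closedSphereCentre θ →⋆ₐ[ℂ] NCTorus θ :=
  (StarAlgHom.ofId ℂ (NCTorus θ)).comp (χ : closedSphereCentre θ →⋆ₐ[ℂ] ℂ)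

theorem characterHom_apply (χ : characterSpace ℂ (closedSphereCentre θ))
    (c : closedSphereCentre θ) : characterHom θ χ c = algebraMap ℂ (NCTorus θ) (χ c) := rfl

theorem sphereToField_z_mul_star (i : Fin m) (t : partialOctant m) :
    sphereToField θ (EvenSphere.z θ i * star (EvenSphere.z θ i)) t =
      ((t.1 i.castSucc ^ 2 : ℝ) : ℂ) • (1 : NCTorus θ) := by
  rw [map_mul, map_star, sphereToField_z]
  change (octantCoord m i.castSucc t • NCTorus.U θ i) *
    star (octantCoord m i.castSucc t • NCTorus.U θ i) = _
  rw [star_smul, smul_mul_smul_comm, (isTorusFamily_U θ).mul_star, octantCoord_apply]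
  simp [sq]

/-- Both sides are continuous `*`-homomorphisms in `c`, so comparing them at `x` and at the `z i *
star (z i)` suffices. -/
theorem sphereToField_eq_characterHom (χ : characterSpace ℂ (closedSphereCentre θ)) :
    ∃ t : partialOctant m, ∀ c : closedSphereCentre θ,
      sphereToField θ c t = algebraMap ℂ (NCTorus θ) (χ c) := by
  obtain ⟨t, ht, ht'⟩ := exists_point_of_character θ χ
  refine ⟨t, fun c => ?_⟩
  have h : ((evalHom _ t).comp (sphereToField θ)).comp (closedSphereCentre θ).subtype =
      characterHom θ χ := by
    have h1 : Continuous (((evalHom _ t).comp (sphereToField θ)).comp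
        (closedSphereCentre θ).subtype) := map_continuous _
    have h2 : Continuous (characterHom θ χ) := map_continuous _
    refine StarAlgHom.ext_topologicalClosure h1 h2 ?_
    refine StarAlgHom.ext_adjoin ?_
    rintro ⟨c, hc⟩ (rfl | ⟨i, rfl⟩)
    · change sphereToField θ (EvenSphere.x θ) t = characterHom θ χ (centralX θ)
      rw [sphereToField_x, characterHom_apply, ht', Algebra.algebraMap_eq_smul_one]
      rfl
    · change sphereToField θ (EvenSphere.z θ i * star (EvenSphere.z θ i)) t =
        characterHom θ χ (centralSq θ i)
      rw [sphereToField_z_mul_star, characterHom_apply, ht, Algebra.algebraMap_eq_smul_one]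
  exact DFunLike.congr_fun h c

variable {θ}

/-- Every character factors through evaluation of the image at some point of the octant, so all
characters vanish at `c`, and the Gelfand transform is injective. -/
theorem eq_zero_of_mem_closedSphereCentre (hθ : θ.transpose = -θ) {c : EvenSphere θ}
    (hc : c ∈ closedSphereCentre θ) (h : sphereToField θ c = 0) : c = 0 := by
  have := nontrivial_ncTorus hθ
  suffices h' : (⟨c, hc⟩ : closedSphereCentre θ) = 0 from congrArg Subtype.val h'
  refine (gelfandTransform_isometry (closedSphereCentre θ)).injective ?_
  rw [map_zero]
  ext χ
  obtain ⟨t, ht⟩ := sphereToField_eq_characterHom θ χ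
  have h1 := ht ⟨c, hc⟩
  rw [h, ContinuousMap.zero_apply] at h1
  exact (FaithfulSMul.algebraMap_eq_zero_iff ℂ (NCTorus θ)).mp h1.symm

/-- Equivariance puts each component `y` of `a` in the kernel. Then `star y * y` is an element of
the kernel in the closed centre, so it vanishes, and `y = 0` by the C*-identity. -/
theorem injective_sphereToField (hθ : θ.transpose = -θ) :
    Function.Injective (sphereToField θ) := by
  rw [injective_iff_map_eq_zero]
  intro a ha
  have hcoeff : ∀ n, torusCoeff n (sphereGauge θ a) = 0 := fun n => by
    set y := torusCoeff n (sphereGauge θ a) with hy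
    have h1 : sphereToField θ y = 0 := by
      have h2 := map_torusCoeff (⟨(sphereToField θ).toLinearMap, map_continuous (sphereToField θ)⟩ :
        EvenSphere θ →L[ℂ] C(partialOctant m, NCTorus θ)) n (F := sphereGauge θ a) (G := 0)
        fun s => ContinuousMap.ext fun t => by
          have := sphereToField_sphereGauge θ a s t
          rw [ha, ContinuousMap.zero_apply, map_zero] at this
          exact this
      rw [map_zero] at h2
      exact h2
    have h3 : star y * y ∈ closedSphereCentre θ :=
      (isGaugeAction_sphereGauge θ).star_mul_self_mem_closure n
        ((isGaugeAction_sphereGauge θ).torusCoeff_mem_closure n a)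
    have h4 := eq_zero_of_mem_closedSphereCentre hθ h3 (by rw [map_mul, h1, mul_zero])
    exact CStarRing.star_mul_self_eq_zero_iff _ |>.mp h4
  -- The orbit takes values in the zero subspace; its value at `0` is `a`.
  have h0 := mem_of_torusCoeff_mem (W := (⊥ : Submodule ℂ (EvenSphere θ))) isClosed_singleton
    (F := sphereGauge θ a) (fun n => (Submodule.mem_bot ℂ).mpr (hcoeff n)) 0
  have h5 : (evalHom _ 0).comp (sphereGauge θ) a = StarAlgHom.id ℂ _ a := by
    refine UniversalCStar.hom_ext (evenSphereRelations θ) ?_ a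
    rintro (_ | i)
    · exact sphereGauge_x θ 0
    · refine (sphereGauge_z θ i 0).trans ?_
      simp
      rfl
  exact h5.symm.trans ((Submodule.mem_bot ℂ).mp h0)

end Injectivity

/-! ### Surjectivity -/

section Surjectivity

open UnitAddTorus
open scoped CStarAlgebra

variable {m : ℕ} (θ : Matrix (Fin m) (Fin m) ℝ)

theorem starMonomial_U_mem_unitary (n : Fin m → ℤ) :
    starMonomial (NCTorus.U θ) n ∈ unitary (NCTorus θ) := by
  refine Submonoid.list_prod_mem _ fun a ha => ?_
  obtain ⟨i, -, rfl⟩ := List.mem_map.mp ha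
  have hU : NCTorus.U θ i ∈ unitary (NCTorus θ) :=
    Unitary.mem_iff.mpr ⟨(isTorusFamily_U θ).star_mul i, (isTorusFamily_U θ).mul_star i⟩
  obtain ⟨k, e | e⟩ := (n i).eq_nat_or_neg
  · rw [e, starZPow_natCast]
    exact pow_mem hU k
  · rw [e, starZPow_neg_natCast]
    exact pow_mem (Unitary.star_mem hU) k

/-- The components of an element of the noncommutative torus are multiples of the monomials. -/
theorem exists_torusCoeff_torusGauge (n : Fin m → ℤ) (a : NCTorus θ) :
    ∃ c : ℂ, torusCoeff n (torusGauge θ a) = c • starMonomial (NCTorus.U θ) n := by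
  have h := (isGaugeAction_torusGauge θ).torusCoeff_mem_closure n a
  have hle : (IsGaugeAction.weightSpace (NCTorus.U θ) ⊥ n : Set (NCTorus θ)) ⊆
      Submodule.span ℂ {starMonomial (NCTorus.U θ) n} := by
    rintro _ ⟨_, ⟨c, rfl⟩, rfl⟩
    refine Submodule.mem_span_singleton.mpr ⟨c, ?_⟩
    exact Algebra.smul_def c _
  -- Here `C` consists of scalars, so the weight space is contained in a line, and passing to the
  -- closure adds nothing outside that line.
  have hcl : IsClosed (Submodule.span ℂ {starMonomial (NCTorus.U θ) n} : Set (NCTorus θ)) :=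
    Submodule.closed_of_finiteDimensional _
  obtain ⟨c, hc⟩ := Submodule.mem_span_singleton.mp (closure_minimal hle hcl h)
  exact ⟨c, hc.symm⟩

/-- The gauge action in the `i`-th direction fixes the `*`-subalgebra generated by the other
generators. -/
theorem torusGauge_add_single {i : Fin m} {a : NCTorus θ} (ha : a ∈ NCTorus.withoutGen θ i)
    (s : UnitAddTorus (Fin m)) (r : UnitAddCircle) :
    torusGauge θ a (s + Pi.single i r) = torusGauge θ a s := by
  have hle : NCTorus.withoutGen θ i ≤ StarAlgHom.equalizer
      ((evalHom _ (s + Pi.single i r)).comp (torusGauge θ)) ((evalHom _ s).comp (torusGauge θ)) := by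
    have hc : ∀ s', Continuous fun a => torusGauge θ a s' := fun s' =>
      map_continuous ((evalHom _ s').comp (torusGauge θ))
    refine StarSubalgebra.topologicalClosure_minimal (StarAlgebra.adjoin_le ?_)
      (isClosed_eq (hc _) (hc _))
    rintro _ ⟨j, hj, rfl⟩
    change torusGauge θ (NCTorus.U θ j) (s + Pi.single i r) = torusGauge θ (NCTorus.U θ j) s
    rw [torusGauge_U, torusGauge_U, Pi.add_apply, Pi.single_eq_of_ne hj, add_zero]
  exact hle ha

/-- The pointwise gauge orbit of a function with values in the noncommutative torus. -/
noncomputable def pointwiseGauge (f : C(partialOctant m, NCTorus θ)) :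
    C(UnitAddTorus (Fin m), C(partialOctant m, NCTorus θ)) :=
  ContinuousMap.curry ((ContinuousMap.uncurry
    ((⟨torusGauge θ, map_continuous _⟩ : C(NCTorus θ, C(UnitAddTorus (Fin m), NCTorus θ))).comp
      f)).comp ContinuousMap.prodSwap)

theorem pointwiseGauge_zero (f : C(partialOctant m, NCTorus θ)) : pointwiseGauge θ f 0 = f := by
  ext t
  refine UniversalCStar.hom_ext (torusRelations θ) (f := (evalHom _ 0).comp (torusGauge θ))
    (g := StarAlgHom.id ℂ _) (fun i => (torusGauge_U θ i 0).trans ?_) (f t)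
  simp
  rfl

theorem torusCoeff_pointwiseGauge (n : Fin m → ℤ) (f : C(partialOctant m, NCTorus θ))
    (t : partialOctant m) :
    torusCoeff n (pointwiseGauge θ f) t = torusCoeff n (torusGauge θ (f t)) :=
  map_torusCoeff (ContinuousMap.evalCLM ℂ t : C(partialOctant m, NCTorus θ) →L[ℂ] NCTorus θ) n
    (F := pointwiseGauge θ f) (G := torusGauge θ (f t)) fun _ => rfl

/-- The embedding of the scalar functions as central elements. -/
noncomputable def scalarHom :
    C(partialOctant m, ℂ) →⋆ₐ[ℂ] C(partialOctant m, NCTorus θ) :=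
  ContinuousMap.compStarAlgHom _ (StarAlgHom.ofId ℂ (NCTorus θ)) (map_continuous _)

theorem scalarHom_apply (g : C(partialOctant m, ℂ)) (t : partialOctant m) :
    scalarHom θ g t = g t • (1 : NCTorus θ) :=
  Algebra.algebraMap_eq_smul_one (A := NCTorus θ) (g t)

theorem scaledConst_eq_scalarHom_mul (g : C(partialOctant m, ℂ)) (a : NCTorus θ) :
    scaledConst g a = scalarHom θ g * ContinuousMap.const _ a := by
  ext t
  rw [ContinuousMap.mul_apply, scalarHom_apply, smul_one_mul]
  rfl

/-- The monomial function `t ↦ ∏ i, t i ^ |n i|`. -/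
noncomputable def octantMonomial (n : Fin m → ℤ) : C(partialOctant m, ℂ) :=
  ∏ i : Fin m, octantCoord m i.castSucc ^ (n i).natAbs

theorem octantMonomial_apply (n : Fin m → ℤ) (t : partialOctant m) :
    octantMonomial n t = ∏ i : Fin m, octantCoord m i.castSucc t ^ (n i).natAbs := by
  simp [octantMonomial, ContinuousMap.prod_apply]

theorem sphereToField_starMonomial (n : Fin m → ℤ) :
    sphereToField θ (starMonomial (EvenSphere.z θ) n) =
      scaledConst (octantMonomial n) (starMonomial (NCTorus.U θ) n) := by
  ext t
  have h := map_starMonomial ((evalHom _ t).comp (sphereToField θ)) (z := EvenSphere.z θ)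
    (w := NCTorus.U θ) (c := fun i => octantCoord m i.castSucc t)
    (fun i => DFunLike.congr_fun (sphereToField_z θ i) t) n
  refine h.trans ?_
  change _ = octantMonomial n t • starMonomial (NCTorus.U θ) n
  simp only [octantMonomial_apply, octantCoord_apply, starZPow_ofReal]

/-- An injective `*`-homomorphism of C*-algebras is isometric. Surjectivity thereby reduces to
approximation. -/
theorem isClosed_range_sphereToField (hθ : θ.transpose = -θ) :
    IsClosed (Set.range (sphereToField θ)) :=
  (NonUnitalStarAlgHom.isometry (sphereToField θ)
    (injective_sphereToField hθ)).isClosedEmbedding.isClosed_range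

/-- Stone–Weierstrass: the range supplies only the squares of the first `m` coordinates, and these
separate points because the coordinates are nonnegative. The last coordinate has no fixed sign, but
it is the image of `x` itself. -/
theorem scalarHom_mem_range (hθ : θ.transpose = -θ) (g : C(partialOctant m, ℂ)) :
    scalarHom θ g ∈ (sphereToField θ).range := by
  set S := ((sphereToField θ).range).comap (scalarHom θ) with hS
  have hclosed : IsClosed (S : Set C(partialOctant m, ℂ)) :=
    (isClosed_range_sphereToField θ hθ).preimage (map_continuous (scalarHom θ))
  have hlast : octantCoord m (Fin.last m) ∈ S :=
    ⟨EvenSphere.x θ, (sphereToField_x θ).trans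
      (ContinuousMap.ext fun t => (scalarHom_apply θ _ t).symm)⟩
  have hsq : ∀ i : Fin m, octantCoord m i.castSucc ^ 2 ∈ S := fun i =>
    ⟨EvenSphere.z θ i * star (EvenSphere.z θ i), ContinuousMap.ext fun t =>
      (sphereToField_z_mul_star θ i t).trans (by
        refine Eq.trans ?_ (scalarHom_apply θ _ t).symm
        rw [ContinuousMap.pow_apply, octantCoord_apply, Complex.ofReal_pow])⟩
  have hsep : S.SeparatesPoints := by
    intro t t' hne
    by_contra hcon
    have key : ∀ h ∈ S, h t = h t' := fun h hh => by
      by_contra hht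
      exact hcon ⟨h, ⟨h, hh, rfl⟩, hht⟩
    refine hne (Subtype.ext ?_)
    ext i
    induction i using Fin.lastCases with
    | last =>
      have := key _ hlast
      simp only [octantCoord_apply] at this
      exact_mod_cast this
    | cast i =>
      have := key _ (hsq i)
      simp only [ContinuousMap.pow_apply, octantCoord_apply] at this
      exact (sq_eq_sq₀ (t.2.2 i) (t'.2.2 i)).mp (by exact_mod_cast this)
  have htop := ContinuousMap.starSubalgebra_topologicalClosure_eq_top_of_separatesPoints S hsep
  have hle := StarSubalgebra.topologicalClosure_minimal le_rfl hclosed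
  rw [htop] at hle
  exact hle (StarSubalgebra.mem_top (x := g))

/-- A scalar function that vanishes at the zeros of `octantMonomial n` is the coefficient of the
monomial with exponents `n` in an element of the range. -/
theorem scaledConst_starMonomial_mem_range (hθ : θ.transpose = -θ) {n : Fin m → ℤ}
    {g : C(partialOctant m, ℂ)} (hg : ∀ t, octantMonomial n t = 0 → g t = 0) :
    scaledConst g (starMonomial (NCTorus.U θ) n) ∈ (sphereToField θ).range := by
  -- A closed ideal of `C(X)` for compact `X` consists of all functions vanishing on its common zero
  -- set. No division by the monomial is needed.
  have hmem : g ∈ closure (Ideal.span {octantMonomial n} : Set C(partialOctant m, ℂ)) := by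
    rw [← Ideal.coe_closure, ← ContinuousMap.idealOfSet_ofIdeal_eq_closure, SetLike.mem_coe,
      ContinuousMap.mem_idealOfSet]
    intro t ht
    refine hg t ?_
    exact ContinuousMap.notMem_setOfIdeal.mp ht (Ideal.subset_span rfl)
  have hcont : Continuous fun g : C(partialOctant m, ℂ) =>
      scaledConst g (starMonomial (NCTorus.U θ) n) := by
    simp only [scaledConst_eq_scalarHom_mul]
    exact (map_continuous (scalarHom θ)).mul
      (continuous_const (y := ContinuousMap.const _ (starMonomial (NCTorus.U θ) n)))
  have hcl : IsClosed {g : C(partialOctant m, ℂ) | scaledConst g (starMonomial (NCTorus.U θ) n) ∈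
      (sphereToField θ).range} := (isClosed_range_sphereToField θ hθ).preimage hcont
  refine closure_minimal (fun g hg => ?_) hcl hmem
  obtain ⟨h, rfl⟩ := Ideal.mem_span_singleton'.mp hg
  rw [Set.mem_ofPred_eq, scaledConst_eq_scalarHom_mul, map_mul, mul_assoc,
    ← scaledConst_eq_scalarHom_mul, ← sphereToField_starMonomial]
  exact mul_mem (scalarHom_mem_range θ hθ h) ⟨_, rfl⟩

/-- The component is `g(t) M` with `M` a unitary monomial. If `octantMonomial n` vanishes at `t`,
then `t_i = 0` for some `i` with `n i ≠ 0`; since `f t ∈ A_θ(i)` is fixed by the gauge action in the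
direction `i`, its component of weight `n` is zero. -/
theorem torusCoeff_pointwiseGauge_mem_range (hθ : θ.transpose = -θ)
    {f : C(partialOctant m, NCTorus θ)} (hf : f ∈ torusField θ) (n : Fin m → ℤ) :
    torusCoeff n (pointwiseGauge θ f) ∈ (sphereToField θ).range := by
  have := nontrivial_ncTorus hθ
  set M := starMonomial (NCTorus.U θ) n with hM
  have hMu : M * star M = 1 := Unitary.mul_star_self_of_mem (starMonomial_U_mem_unitary θ n)
  choose g hg using fun t => exists_torusCoeff_torusGauge θ n (f t)
  have hg' : ∀ t, torusCoeff n (pointwiseGauge θ f) t = g t • M := fun t =>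
    (torusCoeff_pointwiseGauge θ n f t).trans (hg t)
  have halg : ∀ t, algebraMap ℂ (NCTorus θ) (g t) =
      torusCoeff n (pointwiseGauge θ f) t * star M := fun t => by
    rw [hg', smul_mul_assoc, hMu, Algebra.algebraMap_eq_smul_one]
  -- Multiplying by `star M` isolates `g` as a scalar multiple of `1`, and the embedding of the
  -- scalars is isometric.
  have hgc : Continuous g := by
    rw [(algebraMap_isometry ℂ (NCTorus θ)).isEmbedding.continuous_iff]
    exact (show Continuous fun t => torusCoeff n (pointwiseGauge θ f) t * star M by
      fun_prop).congr fun t => (halg t).symm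
  have hzero : ∀ t, octantMonomial n t = 0 → g t = 0 := fun t ht => by
    rw [octantMonomial_apply, Finset.prod_eq_zero_iff] at ht
    obtain ⟨i, -, hi⟩ := ht
    rw [pow_eq_zero_iff', octantCoord_apply, Complex.ofReal_eq_zero, Int.natAbs_ne_zero] at hi
    have h0 : torusCoeff n (torusGauge θ (f t)) = 0 :=
      torusCoeff_eq_zero_of_translate_single hi.2 (torusGauge_add_single θ (hf i t hi.1))
    have h1 := halg t
    rw [torusCoeff_pointwiseGauge, h0, zero_mul] at h1
    exact (FaithfulSMul.algebraMap_eq_zero_iff ℂ (NCTorus θ)).mp h1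
  have hres := scaledConst_starMonomial_mem_range θ hθ (g := ⟨g, hgc⟩) hzero
  have heq : torusCoeff n (pointwiseGauge θ f) = scaledConst ⟨g, hgc⟩ M :=
    ContinuousMap.ext hg'
  rw [heq]
  exact hres

/-- The range is a closed subspace containing all components of `f`, hence contains the value `f` of
its orbit at `0`. -/
theorem torusField_le_range (hθ : θ.transpose = -θ) :
    torusField θ ≤ (sphereToField θ).range := by
  intro f hf
  have h := mem_of_torusCoeff_mem
    (W := Subalgebra.toSubmodule (sphereToField θ).range.toSubalgebra)
    (isClosed_range_sphereToField θ hθ) (torusCoeff_pointwiseGauge_mem_range θ hθ hf) 0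
  rw [pointwiseGauge_zero] at h
  exact h

theorem sphereToField_mem_torusField (a : EvenSphere θ) : sphereToField θ a ∈ torusField θ := by
  intro i t ht
  refine UniversalCStar.mem_of_gen_mem (evenSphereRelations θ)
    (S := (NCTorus.withoutGen θ i).comap ((evalHom _ t).comp (sphereToField θ))) ?_ ?_ a
  · exact (StarSubalgebra.isClosed_topologicalClosure _).preimage
      (map_continuous ((evalHom _ t).comp (sphereToField θ)))
  · rintro (_ | j)
    · change sphereToField θ (EvenSphere.x θ) t ∈ NCTorus.withoutGen θ i
      rw [sphereToField_x]
      exact SMulMemClass.smul_mem _ (one_mem _)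
    · change sphereToField θ (EvenSphere.z θ j) t ∈ NCTorus.withoutGen θ i
      rw [sphereToField_z]
      change octantCoord m j.castSucc t • NCTorus.U θ j ∈ _
      by_cases hj : j = i
      · rw [hj, octantCoord_apply, ht, Complex.ofReal_zero, zero_smul]
        exact zero_mem _
      · exact SMulMemClass.smul_mem _ (StarSubalgebra.le_topologicalClosure _
          (StarAlgebra.subset_adjoin ℂ _ ⟨j, hj, rfl⟩))

end Surjectivity

/-! ### The isomorphism -/

theorem corollary1p7 (m : ℕ) (θ : Matrix (Fin m) (Fin m) ℝ) (hθ : θ.transpose = -θ) :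
    ∃ φ : EvenSphere θ ≃⋆ₐ[ℂ] torusField θ,
      (∀ (i : Fin m) (t : partialOctant m),
        (φ (EvenSphere.z θ i)).1 t = ((t.1 i.castSucc : ℝ) : ℂ) • NCTorus.U θ i) ∧
      ∀ t : partialOctant m,
        (φ (EvenSphere.x θ)).1 t = ((t.1 (Fin.last m) : ℝ) : ℂ) • (1 : NCTorus θ) := by
  refine ⟨StarAlgEquiv.ofBijective
    ((sphereToField θ).codRestrict (torusField θ) (sphereToField_mem_torusField θ)) ⟨?_, ?_⟩,
    fun i t => ?_, fun t => ?_⟩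
  · exact fun a b h => injective_sphereToField hθ (congrArg Subtype.val h)
  · intro f
    obtain ⟨a, ha⟩ := torusField_le_range θ hθ f.2
    exact ⟨a, Subtype.ext ha⟩
  · exact DFunLike.congr_fun (sphereToField_z θ i) t
  · exact DFunLike.congr_fun (sphereToField_x θ) t
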